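/- **Theorem 2 (Uniqueness).** Let $p\in(1,\infty)$, $s\in(0,1)$, let $N>sp$ be an integer and let $\Omega\subset\mathbb R^N$ be a smooth bounded domain. Let $W^{s,p}_0(\Omega)$ be the space of functions $w\in L^p(\mathbb R^N)$ with $\int_{\mathbb R^{2N}}\frac{|w(x)-w(y)|^p}{|x-y|^{N+sp}}\,dx\,dy<\infty$ and $w=0$ a.e. in $\mathbb R^N\setminus\Omega$, and let $W^{s,p}_{\rm loc}(\Omega)$ be the space of functions $w$ with $w\in L^p(K)$ and $\int_{K\times K}\frac{|w(x)-w(y)|^p}{|x-y|^{N+sp}}\,dx\,dy<\infty$ for every compact $K\subset\Omega$. Let $\gamma>0$ and let $f\in L^1(\Omega)$ be non-negative. By a solution we mean a function $u:\mathbb R^N\to\mathbb R$ with $u\in W^{s,p}_{\rm loc}(\Omega)\cap L^{p-1}(\Omega)$, $u>0$ a.e. in $\Omega$, $u=0$ a.e. in $\mathbb R^N\setminus\Omega$, $f/u^\gamma\in L^1_{\rm loc}(\Omega)$, and $$\int_{\mathbb R^{2N}}\frac{|u(x)-u(y)|^{p-2}(u(x)-u(y))(\varphi(x)-\varphi(y))}{|x-y|^{N+sp}}\,dx\,dy=\int_\Omega\frac{f(x)}{u^\gamma}\,\varphi\,dx\qquad\text{for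 every }\varphi\in C^\infty_c(\Omega),$$ which satisfies the zero Dirichlet boundary condition on $\partial\Omega$ in the sense that $(u-\varepsilon)^+\in W^{s,p}_0(\Omega)$ for every $\varepsilon>0$. Then there is at most one solution: if $u$ and $v$ are two solutions, then $u=v$ a.e. in $\mathbb R^N$. -/

import Mathlib

open MeasureTheory Topology Set
open scoped ContDiff

namespace FracPLaplace

/-- The Euclidean space `ℝ^N`. -/
abbrev Space (N : ℕ) : Type := EuclideanSpace ℝ (Fin N)

/-- A smooth bounded domain: an open, connected, bounded set which near each boundary point `x₀` is
the sublevel set `{ρ < 0}` of a `C^∞` function `ρ` with nonzero derivative at `x₀`. -/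
structure IsSmoothBoundedDomain {N : ℕ} (Ω : Set (Space N)) : Prop where
  isOpen : IsOpen Ω
  isConnected : IsConnected Ω
  isBounded : Bornology.IsBounded Ω
  smooth_boundary : ∀ x₀ ∈ frontier Ω, ∃ U ∈ 𝓝 x₀, ∃ ρ : Space N → ℝ,
    ContDiff ℝ ∞ ρ ∧ fderiv ℝ ρ x₀ ≠ 0 ∧ Ω ∩ U = {x | ρ x < 0} ∩ U

/-- The `p`-th power of the Gagliardo seminorm over `A × A`, with values in `[0, ∞]`:
`∫∫_{A × A} |u(x) - u(y)|^p / |x - y|^{N + s p} dx dy`. -/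
noncomputable def gagliardo {N : ℕ} (s p : ℝ) (A : Set (Space N)) (u : Space N → ℝ) : ENNReal :=
  ∫⁻ z in A ×ˢ A, ENNReal.ofReal (|u z.1 - u z.2| ^ p / ‖z.1 - z.2‖ ^ ((N : ℝ) + s * p))
    ∂((volume : Measure (Space N)).prod volume)

/-- `u ∈ W^{s,p}(ℝ^N)`. -/
def MemW {N : ℕ} (s p : ℝ) (u : Space N → ℝ) : Prop :=
  MemLp u (ENNReal.ofReal p) volume ∧ gagliardo s p univ u < ⊤

/-- `u = 0` (a.e.) in `ℝ^N ∖ Ω`. -/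
def VanishesOutside {N : ℕ} (Ω : Set (Space N)) (u : Space N → ℝ) : Prop :=
  ∀ᵐ x ∂(volume : Measure (Space N)), x ∉ Ω → u x = 0

/-- `u ∈ W^{s,p}_0(Ω)`: the functions of `W^{s,p}(ℝ^N)` which vanish outside `Ω`. -/
def MemW0 {N : ℕ} (s p : ℝ) (Ω : Set (Space N)) (u : Space N → ℝ) : Prop :=
  MemW s p u ∧ VanishesOutside Ω u

/-- `u ∈ W^{s,p}_loc(Ω)`. -/
def MemWloc {N : ℕ} (s p : ℝ) (Ω : Set (Space N)) (u : Space N → ℝ) : Prop :=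
  ∀ K : Set (Space N), IsCompact K → K ⊆ Ω →
    MemLp u (ENNReal.ofReal p) (volume.restrict K) ∧ gagliardo s p K u < ⊤

/-- `φ ∈ C^∞_c(Ω)`. -/
structure IsTestFunction {N : ℕ} (Ω : Set (Space N)) (φ : Space N → ℝ) : Prop where
  contDiff : ContDiff ℝ ∞ φ
  hasCompactSupport : HasCompactSupport φ
  tsupport_subset : tsupport φ ⊆ Ω

/-- The weak form of the fractional `p`-Laplacian of `u` tested against `φ`:
`∫∫ |u(x)-u(y)|^{p-2} (u(x)-u(y)) (φ(x)-φ(y)) / |x-y|^{N+sp} dx dy` over `ℝ^N × ℝ^N`. -/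
noncomputable def weakForm {N : ℕ} (s p : ℝ) (u φ : Space N → ℝ) : ℝ :=
  ∫ z, |u z.1 - u z.2| ^ (p - 2) * (u z.1 - u z.2) * (φ z.1 - φ z.2)
      / ‖z.1 - z.2‖ ^ ((N : ℝ) + s * p)
    ∂((volume : Measure (Space N)).prod volume)

/-- `u` is a weak solution of `(-Δ)_p^s u = f / u^γ` in `Ω`, `u > 0` in `Ω`, `u = 0` in
`ℝ^N ∖ Ω`. How `u` attains the boundary value is not part of this definition. -/
structure IsWeakSolution {N : ℕ} (s p γ : ℝ) (Ω : Set (Space N)) (f u : Space N → ℝ) : Prop where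
  memWloc : MemWloc s p Ω u
  memLp : MemLp u (ENNReal.ofReal (p - 1)) (volume.restrict Ω)
  pos : ∀ᵐ x ∂(volume.restrict Ω), 0 < u x
  vanishesOutside : VanishesOutside Ω u
  locallyIntegrable : LocallyIntegrableOn (fun x => f x / u x ^ γ) Ω volume
  weak_eq : ∀ φ : Space N → ℝ, IsTestFunction Ω φ →
    weakForm s p u φ = ∫ x in Ω, f x / u x ^ γ * φ x

/-- `u ≤ 0` on `∂Ω`: `(u - ε)^+ ∈ W^{s,p}_0(Ω)` for every `ε > 0`. -/
def LeZeroOnBoundary {N : ℕ} (s p : ℝ) (Ω : Set (Space N)) (u : Space N → ℝ) : Prop :=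
  ∀ ε : ℝ, 0 < ε → MemW0 s p Ω (fun x => max (u x - ε) 0)

/-- `u = 0` on `∂Ω`: `u` is nonnegative and `u ≤ 0` on `∂Ω`. -/
def EqZeroOnBoundary {N : ℕ} (s p : ℝ) (Ω : Set (Space N)) (u : Space N → ℝ) : Prop :=
  (∀ᵐ x ∂(volume : Measure (Space N)), 0 ≤ u x) ∧ LeZeroOnBoundary s p Ω u

end FracPLaplace

/-! Uniqueness follows from the comparison u ≤ v + ε for every ε > 0: let ε → 0, then exchange u and
v. Formally, both equations are tested with (w - v)^+, where w = (u - ε)^+. Where this function is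
positive, u > v, hence f/u^γ ≤ f/v^γ, so the weak form of u is at most that of v. Since J(t) =
|t|^{p-2} t is strictly increasing, all increments of (w - v)^+ must vanish; it is therefore
constant, and zero because it vanishes outside Ω.

The difficulty is that (w - v)^+ need not be admissible: it may be unbounded, it need not have
compact support in Ω, and v has only local energy. Two facts repair this. By mollification,
`IsWeakSolution.weakForm_eq_of_bounded` extends the equation to bounded compactly supported test
functions of finite local energy. And w, which has global energy and vanishes outside Ω, is
approximated by m n = cutoff · min(w, n), whose increments share one L^p majorant
(`lintegral_truncationMajorant_lt_top`). That majorant is finite by the fractional Hardy inequality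
`IsSmoothBoundedDomain.hardy`, the place where the smoothness of ∂Ω enters.

The test functions are (m n - v)^+. Their energies are bounded uniformly in n: `abs_rpow_le_absorb`
controls them by the increments of m n plus a term whose integral is a negative multiple of the weak
form of v, which is nonnegative because f ≥ 0. Replacing J of the increments of w by J of those of m
n then costs an error tending to 0 in L^1 (`tendsto_lintegral_zero_of_le_rpow_mul`), and Fatou's
lemma completes the formal argument. -/

namespace FracPLaplace
open Filter

/-! ### The odd power and its elementary inequalities -/

/-- The odd power `t ↦ |t|^{p-2} t`. -/
noncomputable def oddPow (p t : ℝ) : ℝ := |t| ^ (p - 2) * t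

lemma oddPow_of_nonneg {p t : ℝ} (hp : 1 < p) (ht : 0 ≤ t) : oddPow p t = t ^ (p - 1) := by
  rcases ht.eq_or_lt with rfl | h
  · simp [oddPow, Real.zero_rpow (by linarith : p - 1 ≠ 0)]
  · rw [oddPow, abs_of_pos h, show p - 1 = (p - 2) + 1 by ring, Real.rpow_add_one h.ne']

lemma oddPow_neg (p t : ℝ) : oddPow p (-t) = -oddPow p t := by
  simp [oddPow]

lemma oddPow_strictMono {p : ℝ} (hp : 1 < p) : StrictMono (oddPow p) := by
  have hpos : ∀ {a b : ℝ}, 0 ≤ a → a < b → oddPow p a < oddPow p b := fun {a b} ha hab => by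
    rw [oddPow_of_nonneg hp ha, oddPow_of_nonneg hp (ha.trans hab.le)]
    exact Real.rpow_lt_rpow ha hab (by linarith)
  have h0 : oddPow p 0 = 0 := by simp [oddPow]
  intro a b hab
  rcases le_or_gt 0 a with ha | ha
  · exact hpos ha hab
  · have h1 : oddPow p a < 0 := by
      have := hpos le_rfl (by linarith : 0 < -a)
      rw [oddPow_neg] at this; linarith
    rcases le_or_gt 0 b with hb | hb
    · rcases hb.eq_or_lt with rfl | hb
      · rwa [h0]
      · have := hpos le_rfl hb; linarith
    · have := hpos (by linarith : 0 ≤ -b) (by linarith : -b < -a)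
      rw [oddPow_neg, oddPow_neg] at this; linarith

lemma abs_oddPow {p : ℝ} (hp : 1 < p) (t : ℝ) : |oddPow p t| = |t| ^ (p - 1) := by
  rw [← oddPow_of_nonneg hp (abs_nonneg t)]
  simp [oddPow, abs_mul, abs_of_nonneg (Real.rpow_nonneg (abs_nonneg t) (p - 2))]

lemma continuous_oddPow {p : ℝ} (hp : 1 < p) : Continuous (oddPow p) := by
  -- For p < 2 the factor |t|^{p-2} blows up near 0; splitting into positive and negative parts
  -- leaves only the positive exponent p - 1.
  have h : oddPow p = fun t => (max t 0) ^ (p - 1) - (max (-t) 0) ^ (p - 1) := by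
    funext t
    have hz : (0 : ℝ) ^ (p - 1) = 0 := Real.zero_rpow (by linarith)
    rcases le_total 0 t with ht | ht
    · rw [max_eq_left ht, max_eq_right (by linarith), hz, oddPow_of_nonneg hp ht, sub_zero]
    · rw [max_eq_right ht, max_eq_left (by linarith), hz, ← oddPow_of_nonneg hp (by linarith),
        oddPow_neg]
      ring
  rw [h]
  exact ((continuous_id.max continuous_const).rpow_const fun _ => Or.inr (by linarith)).sub
    ((continuous_neg.max continuous_const).rpow_const fun _ => Or.inr (by linarith))

lemma measurable_oddPow {p : ℝ} (hp : 1 < p) : Measurable (oddPow p) :=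
  (continuous_oddPow hp).measurable

lemma add_rpow_le {q a b : ℝ} (hq : 0 ≤ q) (ha : 0 ≤ a) (hb : 0 ≤ b) :
    (a + b) ^ q ≤ 2 ^ q * (a ^ q + b ^ q) := by
  have h1 : (a + b) ^ q ≤ (2 * max a b) ^ q :=
    Real.rpow_le_rpow (by positivity) (by linarith [le_max_left a b, le_max_right a b]) hq
  rw [Real.mul_rpow (by norm_num) (le_max_of_le_left ha)] at h1
  refine h1.trans (mul_le_mul_of_nonneg_left ?_ (by positivity))
  have := Real.rpow_nonneg ha q
  have := Real.rpow_nonneg hb q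
  rcases max_choice a b with h | h <;> rw [h] <;> linarith

lemma rpow_sub_one_mul_le {p a b : ℝ} (hp : 1 < p) (ha : 0 ≤ a) (hb : 0 ≤ b) :
    a ^ (p - 1) * b ≤ a ^ p + b ^ p := by
  have key : ∀ {c : ℝ}, 0 ≤ c → c ^ (p - 1) * c = c ^ p := fun {c} hc => by
    rw [← Real.rpow_add_one' hc (by linarith), sub_add_cancel]
  have := Real.rpow_nonneg ha p
  have := Real.rpow_nonneg hb p
  rcases le_total a b with h | h
  · calc a ^ (p - 1) * b ≤ b ^ (p - 1) * b := by gcongr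
      _ ≤ _ := by rw [key hb]; linarith
  · calc a ^ (p - 1) * b ≤ a ^ (p - 1) * a := by gcongr
      _ ≤ _ := by rw [key ha]; linarith

/-- Monotonicity of `oddPow` against any `d` lying between `0` and `a - b`. -/
lemma oddPow_sub_mul_nonneg {p a b d : ℝ} (hp : 1 < p) (h₁ : 0 < d → d ≤ a - b)
    (h₂ : d < 0 → a - b ≤ d) : 0 ≤ (oddPow p a - oddPow p b) * d := by
  rcases lt_trichotomy d 0 with h | rfl | h
  · have := (oddPow_strictMono hp).monotone (by linarith [h₂ h] : a ≤ b)
    nlinarith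
  · simp
  · have := (oddPow_strictMono hp).monotone (by linarith [h₁ h] : b ≤ a)
    exact mul_nonneg (by linarith) h.le

/-- Absorption inequality: `|d|^p` is controlled by `-|b|^{p-2} b d` up to a multiple of `|a|^p`
if `d` lies between `0` and `a - b`. -/
lemma abs_rpow_le_absorb {p a b d : ℝ} (hp : 1 < p) (h₁ : 0 < d → d ≤ a - b)
    (h₂ : d < 0 → a - b ≤ d) :
    |d| ^ p ≤ 2 ^ (p - 1) * -(oddPow p b * d) + 2 ^ (p + 1) * |a| ^ p := by
  have key : ∀ {c : ℝ}, 0 ≤ c → c ^ (p - 1) * c = c ^ p := fun {c} hc => by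
    rw [← Real.rpow_add_one' hc (by linarith), sub_add_cancel]
  have two : (2 : ℝ) ^ p = 2 ^ (p - 1) * 2 := (key (by norm_num)).symm
  have two' : (2 : ℝ) ^ (p + 1) = 2 ^ p * 2 := Real.rpow_add_one (by norm_num) p
  have ha := Real.rpow_nonneg (abs_nonneg a) p
  have h2p : (0 : ℝ) < 2 ^ (p - 1) := by positivity
  have main : ∀ a b d : ℝ, 0 < d → d ≤ a - b →
      d ^ p ≤ 2 ^ (p - 1) * -(oddPow p b * d) + 2 ^ (p + 1) * |a| ^ p := by
    intro a b d hd h₁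
    have ha := Real.rpow_nonneg (abs_nonneg a) p
    -- If d ≥ 2|a|, then -b ≥ d - a ≥ d/2, so d^p is absorbed with constant 2^{p-1}. If d < 2|a|,
    -- then d^p ≤ 2^p |a|^p, and since b ≤ a the b-term may cost a further 2^{p-1} · 2|a|^p; the two
    -- add up to 2^{p+1} |a|^p.
    rcases le_or_gt (2 * |a|) d with h | h
    · have hb : d / 2 ≤ -b := by linarith [le_abs_self a]
      have h3 : (d / 2) ^ (p - 1) ≤ -oddPow p b := by
        rw [← oddPow_neg, oddPow_of_nonneg hp (by linarith)]
        exact Real.rpow_le_rpow (by linarith) hb (by linarith)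
      have h4 : d ^ p = 2 ^ (p - 1) * ((d / 2) ^ (p - 1) * d) := by
        rw [← mul_assoc, ← Real.mul_rpow (by norm_num) (by linarith), mul_div_cancel₀ d two_ne_zero,
          key hd.le]
      have h5 : 2 ^ (p - 1) * ((d / 2) ^ (p - 1) * d) ≤ 2 ^ (p - 1) * -(oddPow p b * d) := by
        rw [← neg_mul]; gcongr
      have : 0 ≤ 2 ^ (p + 1) * |a| ^ p := by positivity
      linarith
    · have h3 : oddPow p b ≤ |a| ^ (p - 1) := by
        rw [← abs_oddPow hp]
        exact ((oddPow_strictMono hp).monotone (by linarith)).trans (le_abs_self _)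
      have h4 : d ^ p ≤ 2 ^ p * |a| ^ p := by
        rw [← Real.mul_rpow (by norm_num) (abs_nonneg a)]
        exact Real.rpow_le_rpow hd.le h.le (by linarith)
      have h5 : oddPow p b * d ≤ 2 * |a| ^ p := by
        calc oddPow p b * d ≤ |a| ^ (p - 1) * d := by gcongr
          _ ≤ |a| ^ (p - 1) * (2 * |a|) := by gcongr
          _ = _ := by rw [← key (abs_nonneg a)]; ring
      have h6 := mul_le_mul_of_nonneg_left h5 h2p.le
      rw [two', two]; rw [two] at h4
      nlinarith
  rcases lt_trichotomy d 0 with h | rfl | h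
  · have := main (-a) (-b) (-d) (by linarith) (by linarith [h₂ h])
    rwa [oddPow_neg, neg_mul_neg, abs_neg, ← abs_of_neg h] at this
  · simp only [abs_zero, Real.zero_rpow (by linarith : p ≠ 0), mul_zero, neg_zero, zero_add]
    positivity
  · rw [abs_of_pos h]; exact main a b d h (h₁ h)

/-! ### Convergence and integral inequalities in L^p -/

section

/-- A weak-strong convergence principle: a sequence dominated by the product of a fixed element of
`L^{p'}` and a bounded sequence in `L^p`, and tending to zero almost everywhere, tends to zero
in `L^1`. -/
lemma tendsto_lintegral_zero_of_le_rpow_mul {X : Type*} [MeasurableSpace X] {ν : Measure X}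
    {p : ℝ} (hp : 1 < p) {T : X → ℝ} {q F : ℕ → X → ℝ} {M : ENNReal}
    (hT : ∀ x, 0 ≤ T x) (hTm : Measurable T) (hTp : ∫⁻ x, ENNReal.ofReal (T x ^ p) ∂ν ≠ ⊤)
    (hq : ∀ n x, 0 ≤ q n x) (hqm : ∀ n, Measurable (q n)) (hM : M ≠ ⊤)
    (hqM : ∀ n, ∫⁻ x, ENNReal.ofReal (q n x ^ p) ∂ν ≤ M)
    (hFm : ∀ n, Measurable (F n)) (hF : ∀ n x, F n x ≤ T x ^ (p - 1) * q n x)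
    (hlim : ∀ᵐ x ∂ν, Tendsto (fun n => F n x) atTop (𝓝 0)) :
    Tendsto (fun n => ∫⁻ x, ENNReal.ofReal (F n x) ∂ν) atTop (𝓝 0) := by
  -- Splitting at level l T^p: where F exceeds it, the bound on F forces l T ≤ q, so T^{p-1} q ≤
  -- l^{1-p} q^p, whose integral is small uniformly in n for large l because p > 1. The part below
  -- the level has the fixed integrable majorant l T^p, so dominated convergence applies.
  have key : ∀ l : ℝ, 0 < l → ∀ n x,
      ENNReal.ofReal (F n x) ≤ ENNReal.ofReal (min (F n x) (l * T x ^ p))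
        + ENNReal.ofReal (l ^ (1 - p)) * ENNReal.ofReal (q n x ^ p) := by
    intro l hl n x
    rcases le_or_gt (F n x) (l * T x ^ p) with h | h
    · rw [min_eq_left h]; exact le_self_add
    · refine le_trans ?_ le_add_self
      rw [← ENNReal.ofReal_mul (by positivity)]
      refine ENNReal.ofReal_le_ofReal ((hF n x).trans ?_)
      rcases (hT x).eq_or_lt with h0 | h0
      · rw [← h0, Real.zero_rpow (by linarith), zero_mul]
        have := Real.rpow_nonneg (hq n x) p
        positivity
      · have e1 : T x ^ p = T x ^ (p - 1) * T x := by
          rw [← Real.rpow_add_one h0.ne', sub_add_cancel]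
        have h1 : l * T x ≤ q n x := by
          have h2 := h.trans_le (hF n x)
          rw [e1] at h2
          have h3 : 0 < T x ^ (p - 1) := by positivity
          nlinarith
        have h4 : T x ≤ q n x / l := by rw [le_div_iff₀ hl]; linarith
        have hqp : 0 < q n x := lt_of_lt_of_le (by positivity) h1
        calc T x ^ (p - 1) * q n x ≤ (q n x / l) ^ (p - 1) * q n x := by
              have := hq n x
              gcongr
          _ = l ^ (1 - p) * q n x ^ p := by
              rw [Real.div_rpow hqp.le hl.le, show 1 - p = -(p - 1) by ring, Real.rpow_neg hl.le,
                div_mul_eq_mul_div, ← Real.rpow_add_one hqp.ne', sub_add_cancel]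
              field_simp
  rw [ENNReal.tendsto_nhds_zero]
  intro ε hε
  obtain ⟨l, hl, hlM⟩ : ∃ l : ℝ, 0 < l ∧ ENNReal.ofReal (l ^ (1 - p)) * M ≤ ε / 2 := by
    have h1 : Tendsto (fun l : ℝ => ENNReal.ofReal (l ^ (1 - p)) * M) atTop (𝓝 0) := by
      have h2 : Tendsto (fun l : ℝ => l ^ (1 - p)) atTop (𝓝 0) := by
        have := tendsto_rpow_neg_atTop (y := p - 1) (by linarith)
        simpa using this
      have h3 := ENNReal.Tendsto.mul_const (b := M) (ENNReal.tendsto_ofReal h2) (Or.inr hM)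
      simpa using h3
    have h4 := ENNReal.tendsto_nhds_zero.1 h1 (ε / 2) (ENNReal.half_pos hε.ne')
    obtain ⟨l, h5, h6⟩ := (h4.and (eventually_gt_atTop 0)).exists
    exact ⟨l, h6, h5⟩
  have hdom : Tendsto (fun n => ∫⁻ x, ENNReal.ofReal (min (F n x) (l * T x ^ p)) ∂ν) atTop
      (𝓝 (∫⁻ _, 0 ∂ν)) := by
    refine tendsto_lintegral_of_dominated_convergence
      (fun x => ENNReal.ofReal l * ENNReal.ofReal (T x ^ p)) (fun n => ?_) (fun n => ?_) ?_ ?_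
    · exact ((hFm n).min ((hTm.pow_const p).const_mul l)).ennreal_ofReal
    · refine Eventually.of_forall fun x => ?_
      dsimp only
      rw [← ENNReal.ofReal_mul hl.le]
      exact ENNReal.ofReal_le_ofReal (min_le_right _ _)
    · rw [lintegral_const_mul _ (hTm.pow_const p).ennreal_ofReal]
      exact ENNReal.mul_ne_top ENNReal.ofReal_ne_top hTp
    · filter_upwards [hlim] with x hx
      have h1 : Tendsto (fun n => min (F n x) (l * T x ^ p)) atTop (𝓝 (min 0 (l * T x ^ p))) :=
        hx.min tendsto_const_nhds
      rw [min_eq_left (by have := Real.rpow_nonneg (hT x) p; positivity)] at h1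
      simpa using ENNReal.tendsto_ofReal h1
  rw [lintegral_zero] at hdom
  filter_upwards [ENNReal.tendsto_nhds_zero.1 hdom (ε / 2) (ENNReal.half_pos hε.ne')] with n hn
  calc ∫⁻ x, ENNReal.ofReal (F n x) ∂ν
      ≤ ∫⁻ x, (ENNReal.ofReal (min (F n x) (l * T x ^ p))
        + ENNReal.ofReal (l ^ (1 - p)) * ENNReal.ofReal (q n x ^ p)) ∂ν :=
        lintegral_mono (key l hl n)
    _ = ∫⁻ x, ENNReal.ofReal (min (F n x) (l * T x ^ p)) ∂ν
        + ENNReal.ofReal (l ^ (1 - p)) * ∫⁻ x, ENNReal.ofReal (q n x ^ p) ∂ν := by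
        rw [lintegral_add_left ((hFm n).min ((hTm.pow_const p).const_mul l)).ennreal_ofReal,
          lintegral_const_mul _ ((hqm n).pow_const p).ennreal_ofReal]
    _ ≤ ε / 2 + ε / 2 := by
        gcongr
        exact (mul_le_mul_right (hqM n) _).trans hlM
    _ = ε := ENNReal.add_halves ε

/-- Finiteness of the `L^p` norm of a sum. -/
lemma lintegral_add_rpow_le {X : Type*} [MeasurableSpace X] {ν : Measure X} {p : ℝ} (hp : 0 ≤ p)
    {a b c : X → ℝ} (ha : ∀ x, 0 ≤ a x) (hb : ∀ x, 0 ≤ b x) (ham : Measurable a)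
    (hc : ∀ x, 0 ≤ c x) (hcab : ∀ x, c x ≤ a x + b x) :
    ∫⁻ x, ENNReal.ofReal (c x ^ p) ∂ν ≤ ENNReal.ofReal (2 ^ p) *
      (∫⁻ x, ENNReal.ofReal (a x ^ p) ∂ν + ∫⁻ x, ENNReal.ofReal (b x ^ p) ∂ν) := by
  rw [← lintegral_add_left (ham.pow_const p).ennreal_ofReal,
    ← lintegral_const_mul' _ _ ENNReal.ofReal_ne_top]
  refine lintegral_mono fun x => ?_
  have h1 := Real.rpow_nonneg (ha x) p
  have h2 := Real.rpow_nonneg (hb x) p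
  rw [← ENNReal.ofReal_add h1 h2, ← ENNReal.ofReal_mul (by positivity)]
  exact ENNReal.ofReal_le_ofReal ((Real.rpow_le_rpow (hc x) (hcab x) hp).trans
    (add_rpow_le hp (ha x) (hb x)))

lemma lintegral_rpow_sub_one_mul_le {X : Type*} [MeasurableSpace X] {ν : Measure X} {p : ℝ}
    (hp : 1 < p) {a b : X → ℝ} (ha : ∀ x, 0 ≤ a x) (hb : ∀ x, 0 ≤ b x) (ham : Measurable a) :
    ∫⁻ x, ENNReal.ofReal (a x ^ (p - 1) * b x) ∂ν ≤
      ∫⁻ x, ENNReal.ofReal (a x ^ p) ∂ν + ∫⁻ x, ENNReal.ofReal (b x ^ p) ∂ν := by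
  rw [← lintegral_add_left (ham.pow_const p).ennreal_ofReal]
  refine lintegral_mono fun x => ?_
  rw [← ENNReal.ofReal_add (Real.rpow_nonneg (ha x) p) (Real.rpow_nonneg (hb x) p)]
  exact ENNReal.ofReal_le_ofReal (rpow_sub_one_mul_le hp (ha x) (hb x))

/-! ### The Gagliardo measure -/

/-- The measure `|x - y|^{-(N + s p)} dx dy` on `ℝ^N × ℝ^N`. -/
noncomputable def gagliardoMeasure (N : ℕ) (s p : ℝ) : Measure (Space N × Space N) :=
  ((volume : Measure (Space N)).prod volume).withDensity
    fun z => ENNReal.ofReal (1 / ‖z.1 - z.2‖ ^ ((N : ℝ) + s * p))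

/-- The difference `u x - u y` as a function of the pair `(x, y)`. -/
def pairDiff {N : ℕ} (u : Space N → ℝ) (z : Space N × Space N) : ℝ := u z.1 - u z.2

variable {N : ℕ} {s p : ℝ}

lemma measurable_pairDiff {u : Space N → ℝ} (hu : Measurable u) : Measurable (pairDiff u) :=
  (hu.comp measurable_fst).sub (hu.comp measurable_snd)

lemma measurable_kernel :
    Measurable fun z : Space N × Space N =>
      ENNReal.ofReal (1 / ‖z.1 - z.2‖ ^ ((N : ℝ) + s * p)) := by
  fun_prop

/-- With the kernel absorbed into the measure, energies become L^p norms of `pairDiff` and the weak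
form becomes an L^{p'}–L^p pairing. On the diagonal the quotient and the density agree through
division by zero. -/
lemma gagliardo_eq {A : Set (Space N)} (hA : MeasurableSet A) (u : Space N → ℝ) :
    gagliardo s p A u =
      ∫⁻ z in A ×ˢ A, ENNReal.ofReal (|pairDiff u z| ^ p) ∂gagliardoMeasure N s p := by
  rw [gagliardoMeasure, setLIntegral_withDensity_eq_setLIntegral_mul_non_measurable _
    measurable_kernel _ (hA.prod hA) (Eventually.of_forall fun _ => ENNReal.ofReal_lt_top),
    gagliardo]
  refine lintegral_congr fun z => ?_
  rw [Pi.mul_apply, ← ENNReal.ofReal_mul (by positivity), div_mul_eq_mul_div, one_mul, pairDiff]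

lemma weakForm_eq (u φ : Space N → ℝ) :
    weakForm s p u φ =
      ∫ z, oddPow p (pairDiff u z) * pairDiff φ z ∂gagliardoMeasure N s p := by
  rw [gagliardoMeasure, integral_withDensity_eq_integral_toReal_smul measurable_kernel
    (Eventually.of_forall fun _ => ENNReal.ofReal_lt_top), weakForm]
  refine integral_congr_ae (Eventually.of_forall fun z => ?_)
  dsimp only
  rw [ENNReal.toReal_ofReal (by positivity), smul_eq_mul, pairDiff, pairDiff, oddPow]
  ring

lemma gagliardoMeasure_ae {P : Space N × Space N → Prop}
    (h : ∀ᵐ z ∂((volume : Measure (Space N)).prod volume), P z) :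
    ∀ᵐ z ∂gagliardoMeasure N s p, P z :=
  (withDensity_absolutelyContinuous _ _).ae_le h

lemma ae_prod_of_ae {P : Space N → Prop} (h : ∀ᵐ x, P x) :
    ∀ᵐ z ∂((volume : Measure (Space N)).prod volume), P z.1 ∧ P z.2 :=
  (Measure.quasiMeasurePreserving_fst.ae h).and (Measure.quasiMeasurePreserving_snd.ae h)

/-- Tonelli for the Gagliardo measure. -/
lemma lintegral_gagliardoMeasure {g : Space N × Space N → ENNReal} (hg : Measurable g) :
    ∫⁻ z, g z ∂gagliardoMeasure N s p =
      ∫⁻ x, ∫⁻ y, ENNReal.ofReal (1 / ‖x - y‖ ^ ((N : ℝ) + s * p)) * g (x, y) := by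
  rw [gagliardoMeasure, lintegral_withDensity_eq_lintegral_mul _ measurable_kernel hg,
    lintegral_prod _ (measurable_kernel.mul hg).aemeasurable]
  rfl

end

/-! ### Integrals of the kernel and the nonlocal tail -/

section

variable {N : ℕ} {s p : ℝ}

/-- In polar coordinates the integrand is y^{p-1-sp} near 0, integrable since s < 1, and y^{-1-sp}
at infinity, integrable since sp > 0. -/
lemma integrable_truncated_kernel [NeZero N] (hs₀ : 0 < s) (hs₁ : s < 1) (hp : 1 < p) :
    Integrable fun z : Space N => min 1 ‖z‖ ^ p / ‖z‖ ^ ((N : ℝ) + s * p) := by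
  have hN : 1 ≤ N := NeZero.one_le
  have hsp : 0 < s * p := by positivity
  have hsp' : s * p < p := by nlinarith
  have : Nontrivial (Space N) := by
    have : Nonempty (Fin N) := ⟨⟨0, hN⟩⟩
    infer_instance
  refine (integrable_fun_norm_addHaar (volume : Measure (Space N))
    (f := fun y : ℝ => min 1 y ^ p / y ^ ((N : ℝ) + s * p))).2 ?_
  rw [finrank_euclideanSpace_fin, ← Ioc_union_Ioi_eq_Ioi zero_le_one]
  have hpow : ∀ y : ℝ, 0 < y → y ^ (N - 1) = y ^ ((N : ℝ) - 1) := fun y hy => by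
    rw [← Real.rpow_natCast, Nat.cast_sub hN, Nat.cast_one]
  refine IntegrableOn.union ?_ ?_
  · have h1 : IntegrableOn (fun y : ℝ => y ^ (p - 1 - s * p)) (Ioc 0 1) :=
      (intervalIntegral.intervalIntegrable_rpow' (by linarith)).1
    refine h1.congr_fun (fun y hy => ?_) measurableSet_Ioc
    dsimp only
    rw [min_eq_right hy.2, hpow y hy.1, smul_eq_mul, ← Real.rpow_sub hy.1, ← Real.rpow_add hy.1]
    congr 1; ring
  · have h1 : IntegrableOn (fun y : ℝ => y ^ (-1 - s * p)) (Ioi 1) :=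
      integrableOn_Ioi_rpow_of_lt (by linarith) one_pos
    refine h1.congr_fun (fun y hy => ?_) measurableSet_Ioi
    have hy0 : (0 : ℝ) < y := zero_lt_one.trans hy
    dsimp only
    rw [min_eq_left (le_of_lt hy), hpow y hy0, smul_eq_mul, Real.one_rpow, one_div,
      ← Real.rpow_neg hy0.le, ← Real.rpow_add hy0]
    congr 1; ring

/-- The truncated kernel at scale `r` has mass proportional to `r^{-s p}`. -/
lemma exists_lintegral_truncated_kernel [NeZero N] (hs₀ : 0 < s) (hs₁ : s < 1) (hp : 1 < p) :
    ∃ C : ENNReal, C ≠ ⊤ ∧ ∀ r : ℝ, 0 < r →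
      ∫⁻ z : Space N, ENNReal.ofReal (min 1 (‖z‖ / r) ^ p / ‖z‖ ^ ((N : ℝ) + s * p)) ≤
        C * ENNReal.ofReal (r ^ (-(s * p))) := by
  have hint := integrable_truncated_kernel (N := N) hs₀ hs₁ hp
  refine ⟨ENNReal.ofReal (∫ z : Space N, min 1 ‖z‖ ^ p / ‖z‖ ^ ((N : ℝ) + s * p)),
    ENNReal.ofReal_ne_top, fun r hr => ?_⟩
  have hscale : ∀ z : Space N, min 1 (‖z‖ / r) ^ p / ‖z‖ ^ ((N : ℝ) + s * p) =
      r ^ (-((N : ℝ) + s * p)) *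
        (min 1 ‖r⁻¹ • z‖ ^ p / ‖r⁻¹ • z‖ ^ ((N : ℝ) + s * p)) := fun z => by
    have : ‖r⁻¹ • z‖ = ‖z‖ / r := by
      rw [norm_smul, norm_inv, Real.norm_eq_abs, abs_of_pos hr, div_eq_inv_mul]
    rw [this, Real.div_rpow (norm_nonneg z) hr.le, Real.rpow_neg hr.le]
    have : 0 < r ^ ((N : ℝ) + s * p) := by positivity
    field_simp
  have hint' : Integrable fun z : Space N =>
      min 1 (‖z‖ / r) ^ p / ‖z‖ ^ ((N : ℝ) + s * p) := by
    simp_rw [hscale]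
    exact ((integrable_comp_smul_iff volume
      (fun z : Space N => min 1 ‖z‖ ^ p / ‖z‖ ^ ((N : ℝ) + s * p)) (inv_ne_zero hr.ne')).2
        hint).const_mul _
  rw [← ofReal_integral_eq_lintegral_ofReal hint'
    (Eventually.of_forall fun z => by dsimp; positivity)]
  simp_rw [hscale]
  rw [integral_const_mul, Measure.integral_comp_smul volume
    (fun z : Space N => min 1 ‖z‖ ^ p / ‖z‖ ^ ((N : ℝ) + s * p)), finrank_euclideanSpace_fin,
    smul_eq_mul, ← ENNReal.ofReal_mul (integral_nonneg fun z => by dsimp; positivity),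
    inv_pow, inv_inv, abs_of_pos (by positivity)]
  refine ENNReal.ofReal_le_ofReal (le_of_eq ?_)
  rw [← mul_assoc, ← Real.rpow_natCast r N, ← Real.rpow_add hr,
    show -((N : ℝ) + s * p) + N = -(s * p) by ring, mul_comm]

/-- The kernel is integrable away from the origin. -/
lemma lintegral_kernel_tail_lt_top [NeZero N] (hs₀ : 0 < s) (hs₁ : s < 1) (hp : 1 < p) {δ : ℝ}
    (hδ : 0 < δ) :
    ∫⁻ z in {z : Space N | δ ≤ ‖z‖}, ENNReal.ofReal (1 / ‖z‖ ^ ((N : ℝ) + s * p)) < ⊤ := by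
  obtain ⟨C, hC, h⟩ := exists_lintegral_truncated_kernel (N := N) hs₀ hs₁ hp
  refine lt_of_le_of_lt (le_trans ?_ (h δ hδ)) (ENNReal.mul_lt_top hC.lt_top ENNReal.ofReal_lt_top)
  refine le_trans (setLIntegral_mono' (measurableSet_le measurable_const measurable_norm)
    fun z hz => ?_) (setLIntegral_le_lintegral _ _)
  rw [min_eq_left ((one_le_div hδ).2 hz), Real.one_rpow]

lemma lintegral_gagliardoMeasure_swap {g : Space N × Space N → ENNReal} (hg : Measurable g) :
    ∫⁻ z, g z.swap ∂gagliardoMeasure N s p = ∫⁻ z, g z ∂gagliardoMeasure N s p := by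
  change ∫⁻ z, (g ∘ Prod.swap) z ∂gagliardoMeasure N s p = _
  rw [gagliardoMeasure, lintegral_withDensity_eq_lintegral_mul _ measurable_kernel hg,
    lintegral_withDensity_eq_lintegral_mul _ measurable_kernel (hg.comp measurable_swap)]
  refine Eq.trans ?_ (lintegral_prod_swap _)
  refine lintegral_congr fun z => ?_
  simp [norm_sub_rev]

/-- Integrability of the nonlocal tail. -/
lemma lintegral_tail_lt_top [NeZero N] (hs₀ : 0 < s) (hs₁ : s < 1) (hp : 1 < p)
    {u : Space N → ℝ} (hu : Measurable u) (hup : ∫⁻ x, ENNReal.ofReal (|u x| ^ (p - 1)) < ⊤)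
    {K : Set (Space N)} (hK : MeasurableSet K) (hKv : volume K < ⊤) {δ : ℝ} (hδ : 0 < δ) :
    ∫⁻ z in {z : Space N × Space N | (z.1 ∈ K ∨ z.2 ∈ K) ∧ δ ≤ ‖z.1 - z.2‖},
      ENNReal.ofReal |oddPow p (pairDiff u z)| ∂gagliardoMeasure N s p < ⊤ := by
  set S : Set (Space N × Space N) := {z | δ ≤ ‖z.1 - z.2‖} with hS
  have hSm : MeasurableSet S := measurableSet_le measurable_const (by fun_prop)
  have hKp : MeasurableSet {z : Space N × Space N | z.1 ∈ K} := measurable_fst hK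
  set U : Space N → ENNReal := fun x => ENNReal.ofReal (|u x| ^ (p - 1)) with hU
  have hUm : Measurable U := (hu.abs.pow_const _).ennreal_ofReal
  set g : Space N × Space N → ENNReal := ({z | z.1 ∈ K} ∩ S).indicator
    fun z => ENNReal.ofReal |oddPow p (pairDiff u z)| with hg
  have hJm : Measurable fun z => ENNReal.ofReal |oddPow p (pairDiff u z)| :=
    ((measurable_oddPow hp).comp (measurable_pairDiff hu)).abs.ennreal_ofReal
  have hgm : Measurable g := hJm.indicator (hKp.inter hSm)
  have hker : ∀ x : Space N, ∫⁻ y, ENNReal.ofReal (1 / ‖x - y‖ ^ ((N : ℝ) + s * p)) *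
      {y | δ ≤ ‖x - y‖}.indicator 1 y =
      ∫⁻ z in {z : Space N | δ ≤ ‖z‖}, ENNReal.ofReal (1 / ‖z‖ ^ ((N : ℝ) + s * p)) := fun x => by
    rw [← lintegral_indicator (measurableSet_le measurable_const measurable_norm),
      ← lintegral_sub_left_eq_self _ x]
    refine lintegral_congr fun y => ?_
    simp [indicator]
  set A := ∫⁻ z in {z : Space N | δ ≤ ‖z‖}, ENNReal.ofReal (1 / ‖z‖ ^ ((N : ℝ) + s * p)) with hA
  have hAt : A < ⊤ := lintegral_kernel_tail_lt_top hs₀ hs₁ hp hδ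
  have hgfin : ∫⁻ z, g z ∂gagliardoMeasure N s p < ⊤ := by
    rw [lintegral_gagliardoMeasure hgm]
    -- |J(u x - u y)| is at most 2^{p-1} times |u x|^{p-1} + |u y|^{p-1}. The first summand is
    -- paired with the tail mass of the kernel in y; for the second the kernel is at most
    -- δ^{-(N+sp)} and x ranges over the finite-measure set K.
    have hbound : ∀ x y, ENNReal.ofReal (1 / ‖x - y‖ ^ ((N : ℝ) + s * p)) * g (x, y) ≤
        ENNReal.ofReal (2 ^ (p - 1)) * (U x * (ENNReal.ofReal (1 / ‖x - y‖ ^ ((N : ℝ) + s * p)) *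
          {y | δ ≤ ‖x - y‖}.indicator 1 y) +
          K.indicator 1 x * (ENNReal.ofReal (1 / δ ^ ((N : ℝ) + s * p)) * U y)) := fun x y => by
      by_cases h : x ∈ K ∧ δ ≤ ‖x - y‖
      · have h' : (x, y) ∈ {z : Space N × Space N | z.1 ∈ K} ∩ S := h
        rw [hg, indicator_of_mem h', indicator_of_mem (show y ∈ {y | δ ≤ ‖x - y‖} from h.2),
          indicator_of_mem h.1]
        simp only [Pi.one_apply, mul_one, one_mul]
        have h1 : ENNReal.ofReal |oddPow p (pairDiff u (x, y))| ≤
            ENNReal.ofReal (2 ^ (p - 1)) * (U x + U y) := by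
          rw [hU, ← ENNReal.ofReal_add (by positivity) (by positivity),
            ← ENNReal.ofReal_mul (by positivity), abs_oddPow hp]
          refine ENNReal.ofReal_le_ofReal (le_trans ?_
            (add_rpow_le (by linarith) (abs_nonneg _) (abs_nonneg _)))
          exact Real.rpow_le_rpow (abs_nonneg _) (abs_sub _ _) (by linarith)
        have h2 : ENNReal.ofReal (1 / ‖x - y‖ ^ ((N : ℝ) + s * p)) ≤
            ENNReal.ofReal (1 / δ ^ ((N : ℝ) + s * p)) := by
          refine ENNReal.ofReal_le_ofReal (one_div_le_one_div_of_le (by positivity) ?_)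
          exact Real.rpow_le_rpow hδ.le h.2 (by positivity)
        calc _ ≤ ENNReal.ofReal (1 / ‖x - y‖ ^ ((N : ℝ) + s * p)) *
              (ENNReal.ofReal (2 ^ (p - 1)) * (U x + U y)) := by gcongr
          _ = ENNReal.ofReal (2 ^ (p - 1)) *
              (U x * ENNReal.ofReal (1 / ‖x - y‖ ^ ((N : ℝ) + s * p)) +
                ENNReal.ofReal (1 / ‖x - y‖ ^ ((N : ℝ) + s * p)) * U y) := by ring
          _ ≤ _ := by gcongr
      · have h' : (x, y) ∉ {z : Space N × Space N | z.1 ∈ K} ∩ S := h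
        rw [hg, indicator_of_notMem h', mul_zero]
        exact zero_le
    have hkm : ∀ x : Space N, Measurable fun y =>
        ENNReal.ofReal (1 / ‖x - y‖ ^ ((N : ℝ) + s * p)) * {y | δ ≤ ‖x - y‖}.indicator 1 y :=
      fun x => by
        refine Measurable.mul (by fun_prop) (measurable_one.indicator ?_)
        exact measurableSet_le measurable_const (by fun_prop)
    calc _ ≤ ∫⁻ x, ∫⁻ y, ENNReal.ofReal (2 ^ (p - 1)) *
          (U x * (ENNReal.ofReal (1 / ‖x - y‖ ^ ((N : ℝ) + s * p)) *
          {y | δ ≤ ‖x - y‖}.indicator 1 y) +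
          K.indicator 1 x * (ENNReal.ofReal (1 / δ ^ ((N : ℝ) + s * p)) * U y)) :=
          lintegral_mono fun x => lintegral_mono fun y => hbound x y
      _ = ∫⁻ x, ENNReal.ofReal (2 ^ (p - 1)) * (U x * A +
          K.indicator 1 x * (ENNReal.ofReal (1 / δ ^ ((N : ℝ) + s * p)) * ∫⁻ y, U y)) := by
          refine lintegral_congr fun x => ?_
          rw [lintegral_const_mul' _ _ ENNReal.ofReal_ne_top,
            lintegral_add_left ((hkm x).const_mul _), lintegral_const_mul _ (hkm x), hker,
            lintegral_const_mul _ (hUm.const_mul _), lintegral_const_mul _ hUm]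
      _ = ENNReal.ofReal (2 ^ (p - 1)) * ((∫⁻ x, U x) * A +
          volume K * (ENNReal.ofReal (1 / δ ^ ((N : ℝ) + s * p)) * ∫⁻ y, U y)) := by
          rw [lintegral_const_mul' _ _ ENNReal.ofReal_ne_top,
            lintegral_add_left (hUm.mul_const _), lintegral_mul_const _ hUm,
            lintegral_mul_const _ (measurable_one.indicator hK), lintegral_indicator_one hK]
      _ < ⊤ := by
          refine ENNReal.mul_lt_top ENNReal.ofReal_lt_top (ENNReal.add_lt_top.2
            ⟨ENNReal.mul_lt_top hup hAt, ENNReal.mul_lt_top hKv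
              (ENNReal.mul_lt_top ENNReal.ofReal_lt_top hup)⟩)
  have hmeas : MeasurableSet {z : Space N × Space N | (z.1 ∈ K ∨ z.2 ∈ K) ∧ δ ≤ ‖z.1 - z.2‖} :=
    (hKp.union (measurable_snd hK)).inter hSm
  rw [← lintegral_indicator hmeas]
  refine lt_of_le_of_lt (lintegral_mono (g := fun z => g z + g z.swap) fun z => ?_) ?_
  · by_cases h : z ∈ {z : Space N × Space N | (z.1 ∈ K ∨ z.2 ∈ K) ∧ δ ≤ ‖z.1 - z.2‖}
    · rw [indicator_of_mem h]
      rcases h with ⟨h1 | h1, h2⟩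
      · dsimp only
        rw [hg, indicator_of_mem (show z ∈ {z | z.1 ∈ K} ∩ S from ⟨h1, h2⟩)]
        exact le_self_add
      · have h3 : z.swap ∈ {z | z.1 ∈ K} ∩ S :=
          ⟨h1, by change δ ≤ ‖z.2 - z.1‖; rwa [norm_sub_rev]⟩
        dsimp only
        rw [hg, indicator_of_mem h3]
        refine le_trans (le_of_eq ?_) le_add_self
        have : pairDiff u z.swap = -pairDiff u z := by simp [pairDiff]
        rw [this, oddPow_neg, abs_neg]
    · rw [indicator_of_notMem h]; exact zero_le
  · rw [lintegral_add_left hgm, lintegral_gagliardoMeasure_swap hgm]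
    exact ENNReal.add_lt_top.2 ⟨hgfin, hgfin⟩

end

/-! ### Convergence and continuity of the weak form -/

section

variable {N : ℕ} {s p : ℝ}

lemma integrableOn_oddPow_mul_tail [NeZero N] (hs₀ : 0 < s) (hs₁ : s < 1) (hp : 1 < p)
    {u : Space N → ℝ} (hu : Measurable u) (hup : ∫⁻ x, ENNReal.ofReal (|u x| ^ (p - 1)) < ⊤)
    {K : Set (Space N)} (hK : IsCompact K) {δ : ℝ} (hδ : 0 < δ) (M : ℝ) :
    Integrable ({z : Space N × Space N | (z.1 ∈ K ∨ z.2 ∈ K) ∧ δ ≤ ‖z.1 - z.2‖}.indicator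
      fun z => |oddPow p (pairDiff u z)| * M) (gagliardoMeasure N s p) := by
  have hm : Measurable fun z => |oddPow p (pairDiff u z)| :=
    ((measurable_oddPow hp).comp (measurable_pairDiff hu)).abs
  have hS : MeasurableSet {z : Space N × Space N | (z.1 ∈ K ∨ z.2 ∈ K) ∧ δ ≤ ‖z.1 - z.2‖} :=
    ((measurable_fst hK.measurableSet).union (measurable_snd hK.measurableSet)).inter
      (measurableSet_le measurable_const (measurable_fst.sub measurable_snd).norm)
  rw [integrable_indicator_iff hS]
  refine Integrable.mul_const ⟨hm.aestronglyMeasurable, ?_⟩ M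
  refine lt_of_eq_of_lt (lintegral_congr fun z => ?_)
    (lintegral_tail_lt_top hs₀ hs₁ hp hu hup hK.measurableSet hK.measure_lt_top hδ)
  rw [Real.enorm_eq_ofReal (abs_nonneg _)]

/-- Off L × L, a pair contributes only if one point lies in K ⊆ L; the other is then outside L, at
distance at least δ. The singularity of the kernel is thus never met there, and the tail bound
supplies an integrable majorant that depends on the test function only through M. -/
lemma abs_oddPow_mul_pairDiff_le {u φ : Space N → ℝ} {K L : Set (Space N)} {δ M : ℝ} (hδ : 0 < δ)
    (hsep : ∀ x ∈ K, ∀ y ∉ L, δ ≤ ‖x - y‖) (hM : ∀ x, |φ x| ≤ M) (hφ : ∀ x ∉ K, φ x = 0)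
    {z : Space N × Space N} (hz : z ∉ L ×ˢ L) :
    |oddPow p (pairDiff u z) * pairDiff φ z| ≤
      {z : Space N × Space N | (z.1 ∈ K ∨ z.2 ∈ K) ∧ δ ≤ ‖z.1 - z.2‖}.indicator
        (fun z => |oddPow p (pairDiff u z)| * (2 * M)) z := by
  have hKL : K ⊆ L := fun x hx => by
    by_contra h
    have := hsep x hx x h
    simp at this
    linarith
  by_cases h : z.1 ∈ K ∨ z.2 ∈ K
  · have h2 : δ ≤ ‖z.1 - z.2‖ := by
      rcases h with h | h
      · exact hsep _ h _ fun h' => hz ⟨hKL h, h'⟩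
      · rw [norm_sub_rev]; exact hsep _ h _ fun h' => hz ⟨h', hKL h⟩
    rw [indicator_of_mem (show z ∈ {z : Space N × Space N |
      (z.1 ∈ K ∨ z.2 ∈ K) ∧ δ ≤ ‖z.1 - z.2‖} from ⟨h, h2⟩), abs_mul]
    refine mul_le_mul_of_nonneg_left ?_ (abs_nonneg _)
    calc |φ z.1 - φ z.2| ≤ |φ z.1| + |φ z.2| := abs_sub _ _
      _ ≤ 2 * M := by linarith [hM z.1, hM z.2]
  · rw [indicator_of_notMem (fun h' => h h'.1)]
    simp only [not_or] at h
    simp [pairDiff, hφ _ h.1, hφ _ h.2]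

/-- The weak form is an absolutely convergent integral for bounded test functions of finite
local energy supported well inside `L`. -/
lemma integrable_weakForm [NeZero N] (hs₀ : 0 < s) (hs₁ : s < 1) (hp : 1 < p)
    {u φ : Space N → ℝ} (hu : Measurable u) (hφm : Measurable φ)
    (hup : ∫⁻ x, ENNReal.ofReal (|u x| ^ (p - 1)) < ⊤)
    {K L : Set (Space N)} (hK : IsCompact K) (hL : IsCompact L) {δ M : ℝ} (hδ : 0 < δ)
    (hsep : ∀ x ∈ K, ∀ y ∉ L, δ ≤ ‖x - y‖) (hM : ∀ x, |φ x| ≤ M) (hφ : ∀ x ∉ K, φ x = 0)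
    (huL : gagliardo s p L u < ⊤) (hφL : gagliardo s p L φ < ⊤) :
    Integrable (fun z => oddPow p (pairDiff u z) * pairDiff φ z) (gagliardoMeasure N s p) := by
  have hLm : MeasurableSet (L ×ˢ L) := hL.measurableSet.prod hL.measurableSet
  have hm : Measurable fun z => oddPow p (pairDiff u z) * pairDiff φ z :=
    ((measurable_oddPow hp).comp (measurable_pairDiff hu)).mul (measurable_pairDiff hφm)
  rw [← integrableOn_univ, ← union_compl_self (L ×ˢ L)]
  refine IntegrableOn.union ⟨hm.aestronglyMeasurable, ?_⟩ ?_
  · rw [gagliardo_eq hL.measurableSet] at huL hφL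
    refine lt_of_le_of_lt (le_of_eq_of_le (lintegral_congr fun z => ?_)
      (lintegral_rpow_sub_one_mul_le hp (a := fun z => |pairDiff u z|)
        (b := fun z => |pairDiff φ z|) (fun _ => abs_nonneg _) (fun _ => abs_nonneg _)
        (measurable_pairDiff hu).abs)) (ENNReal.add_lt_top.2 ⟨huL, hφL⟩)
    rw [← abs_oddPow hp, ← abs_mul, ← Real.enorm_eq_ofReal_abs]
  · refine Integrable.mono'
      (integrableOn_oddPow_mul_tail hs₀ hs₁ hp hu hup hK hδ (2 * M)).integrableOn
      hm.aestronglyMeasurable ?_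
    filter_upwards [ae_restrict_mem hLm.compl] with z hz
    exact abs_oddPow_mul_pairDiff_le hδ hsep hM hφ hz

/-- Continuity of the weak form along sequences of test functions which are uniformly bounded, of
bounded local energy, and converge almost everywhere. -/
lemma tendsto_weakForm [NeZero N] (hs₀ : 0 < s) (hs₁ : s < 1) (hp : 1 < p)
    {u φ : Space N → ℝ} {ψ : ℕ → Space N → ℝ} (hu : Measurable u) (hφm : Measurable φ)
    (hψm : ∀ n, Measurable (ψ n)) (hup : ∫⁻ x, ENNReal.ofReal (|u x| ^ (p - 1)) < ⊤)
    {K L : Set (Space N)} (hK : IsCompact K) (hL : IsCompact L) {δ M : ℝ} (hδ : 0 < δ)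
    (hsep : ∀ x ∈ K, ∀ y ∉ L, δ ≤ ‖x - y‖) (hM : ∀ x, |φ x| ≤ M) (hφ : ∀ x ∉ K, φ x = 0)
    (hψM : ∀ n x, |ψ n x| ≤ M) (hψ : ∀ n, ∀ x ∉ K, ψ n x = 0)
    (huL : gagliardo s p L u < ⊤) (hφL : gagliardo s p L φ < ⊤) {B : ENNReal} (hB : B < ⊤)
    (hψL : ∀ n, gagliardo s p L (ψ n) ≤ B)
    (hlim : ∀ᵐ x, Tendsto (fun n => ψ n x) atTop (𝓝 (φ x))) :
    Tendsto (fun n => weakForm s p u (ψ n)) atTop (𝓝 (weakForm s p u φ)) := by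
  have hLm : MeasurableSet (L ×ˢ L) := hL.measurableSet.prod hL.measurableSet
  have hJm : Measurable fun z => oddPow p (pairDiff u z) :=
    (measurable_oddPow hp).comp (measurable_pairDiff hu)
  have hlim' : ∀ᵐ z ∂gagliardoMeasure N s p,
      Tendsto (fun n => pairDiff (ψ n) z) atTop (𝓝 (pairDiff φ z)) := by
    refine gagliardoMeasure_ae ?_
    filter_upwards [ae_prod_of_ae hlim] with z hz using hz.1.sub hz.2
  have hint := integrable_weakForm hs₀ hs₁ hp hu hφm hup hK hL hδ hsep hM hφ huL hφL
  have hint' := fun n => integrable_weakForm hs₀ hs₁ hp hu (hψm n) hup hK hL hδ hsep (hψM n)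
    (hψ n) huL ((hψL n).trans_lt hB)
  simp_rw [weakForm_eq]
  rw [← integral_add_compl hLm hint]
  simp_rw [fun n => (integral_add_compl hLm (hint' n)).symm]
  -- On L × L the energies of ψ n are merely bounded, so the weak-strong principle is applied
  -- against the fixed L^p function |`pairDiff u`|. Off L × L the nonlocal tail dominates.
  refine Tendsto.add ?_ ?_
  · refine tendsto_integral_of_L1 _ hint.1.restrict
      (Eventually.of_forall fun n => (hint' n).integrableOn) ?_
    rw [gagliardo_eq hL.measurableSet] at huL hφL
    have hd : ∀ n, Measurable fun z => |pairDiff (ψ n) z - pairDiff φ z| := fun n =>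
      ((measurable_pairDiff (hψm n)).sub (measurable_pairDiff hφm)).abs
    have hbd : ∀ n, ∫⁻ z in L ×ˢ L, ENNReal.ofReal (|pairDiff (ψ n) z - pairDiff φ z| ^ p)
        ∂gagliardoMeasure N s p ≤ ENNReal.ofReal (2 ^ p) *
          (B + ∫⁻ z in L ×ˢ L, ENNReal.ofReal (|pairDiff φ z| ^ p) ∂gagliardoMeasure N s p) := by
      intro n
      refine (lintegral_add_rpow_le (by linarith) (fun _ => abs_nonneg _) (fun _ => abs_nonneg _)
        (measurable_pairDiff (hψm n)).abs (fun _ => abs_nonneg _)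
        (fun z => abs_sub (pairDiff (ψ n) z) (pairDiff φ z))).trans ?_
      gcongr
      rw [← gagliardo_eq hL.measurableSet]
      exact hψL n
    have := tendsto_lintegral_zero_of_le_rpow_mul (ν := (gagliardoMeasure N s p).restrict (L ×ˢ L))
      hp (T := fun z => |pairDiff u z|) (q := fun n z => |pairDiff (ψ n) z - pairDiff φ z|)
      (F := fun n z => |oddPow p (pairDiff u z)| * |pairDiff (ψ n) z - pairDiff φ z|)
      (fun _ => abs_nonneg _) (measurable_pairDiff hu).abs huL.ne (fun _ _ => abs_nonneg _) hd
      (ENNReal.mul_lt_top ENNReal.ofReal_lt_top (ENNReal.add_lt_top.2 ⟨hB, hφL⟩)).ne hbd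
      (fun n => hJm.abs.mul (hd n)) (fun n z => (by rw [abs_oddPow hp])) ?_
    · refine this.congr fun n => lintegral_congr fun z => ?_
      rw [← mul_sub, ← abs_mul, ← Real.enorm_eq_ofReal_abs]
    · filter_upwards [ae_restrict_of_ae hlim'] with z hz
      have h1 := ((hz.sub_const (pairDiff φ z)).abs).const_mul |oddPow p (pairDiff u z)|
      simpa using h1
  · refine tendsto_integral_of_dominated_convergence _
      (fun n => (hint' n).1.restrict)
      (integrableOn_oddPow_mul_tail hs₀ hs₁ hp hu hup hK hδ (2 * M)).integrableOn
      (fun n => ?_) ?_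
    · filter_upwards [ae_restrict_mem hLm.compl] with z hz
      exact abs_oddPow_mul_pairDiff_le hδ hsep (hψM n) (hψ n) hz
    · filter_upwards [ae_restrict_of_ae hlim'] with z hz using hz.const_mul _

end

/-! ### Mollification and enlarging the class of test functions -/

section

variable {N : ℕ} {s p : ℝ}

/-- The Gagliardo measure is invariant under diagonal translations. -/
lemma lintegral_gagliardoMeasure_sub {g : Space N × Space N → ENNReal} (hg : Measurable g)
    (t : Space N) :
    ∫⁻ z, g (z.1 - t, z.2 - t) ∂gagliardoMeasure N s p = ∫⁻ z, g z ∂gagliardoMeasure N s p := by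
  have hmp : MeasurePreserving (Prod.map (fun x : Space N => x - t) (fun x : Space N => x - t))
      ((volume : Measure (Space N)).prod volume) (volume.prod volume) :=
    (measurePreserving_sub_right volume t).prod (measurePreserving_sub_right volume t)
  change ∫⁻ z, (g ∘ Prod.map (fun x : Space N => x - t) (fun x : Space N => x - t)) z
    ∂gagliardoMeasure N s p = _
  rw [gagliardoMeasure, lintegral_withDensity_eq_lintegral_mul _ measurable_kernel hg,
    lintegral_withDensity_eq_lintegral_mul _ measurable_kernel (hg.comp hmp.measurable),
    ← hmp.lintegral_comp (measurable_kernel.mul hg)]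
  refine lintegral_congr fun z => ?_
  simp

/-- Mollification of `φ` by the normed bump `ρ`. -/
noncomputable def mollify (ρ : ContDiffBump (0 : Space N)) (φ : Space N → ℝ) : Space N → ℝ :=
  convolution (ρ.normed volume) φ (ContinuousLinearMap.lsmul ℝ ℝ) volume

lemma locallyIntegrable_of_bounded {φ : Space N → ℝ} {M : ℝ} (hφm : Measurable φ)
    (hM : ∀ x, |φ x| ≤ M) : LocallyIntegrable φ volume :=
  (locallyIntegrable_const M).mono hφm.aestronglyMeasurable
    (Eventually.of_forall fun x => (hM x).trans (le_abs_self M))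

/-- The probability measure with density `ρ`. -/
noncomputable def bumpMeasure (ρ : ContDiffBump (0 : Space N)) : Measure (Space N) :=
  volume.withDensity fun t => ENNReal.ofReal (ρ.normed volume t)

lemma measurable_bump (ρ : ContDiffBump (0 : Space N)) :
    Measurable fun t => ENNReal.ofReal (ρ.normed volume t) :=
  (ρ.continuous_normed (μ := volume)).measurable.ennreal_ofReal

instance (ρ : ContDiffBump (0 : Space N)) : IsProbabilityMeasure (bumpMeasure ρ) := by
  constructor
  rw [bumpMeasure, withDensity_apply _ MeasurableSet.univ, Measure.restrict_univ,
    ← ofReal_integral_eq_lintegral_ofReal ρ.integrable_normed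
      (Eventually.of_forall fun t => ρ.nonneg_normed t), ρ.integral_normed, ENNReal.ofReal_one]

lemma bumpMeasure_ae (ρ : ContDiffBump (0 : Space N)) : ∀ᵐ t ∂bumpMeasure ρ, ‖t‖ < ρ.rOut := by
  rw [bumpMeasure, ae_withDensity_iff (measurable_bump ρ)]
  refine Eventually.of_forall fun t ht => ?_
  have h : t ∈ Function.support (ρ.normed volume) := fun h => ht (by rw [h, ENNReal.ofReal_zero])
  rw [ρ.support_normed_eq] at h
  simpa using h

lemma mollify_eq (ρ : ContDiffBump (0 : Space N)) (φ : Space N → ℝ) (x : Space N) :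
    mollify ρ φ x = ∫ t, φ (x - t) ∂bumpMeasure ρ := by
  rw [bumpMeasure, integral_withDensity_eq_integral_toReal_smul (measurable_bump ρ)
    (Eventually.of_forall fun _ => ENNReal.ofReal_lt_top), mollify, convolution_def]
  refine integral_congr_ae (Eventually.of_forall fun t => ?_)
  dsimp only
  rw [ENNReal.toReal_ofReal (ρ.nonneg_normed t), ContinuousLinearMap.lsmul_apply]

lemma abs_mollify_le (ρ : ContDiffBump (0 : Space N)) {φ : Space N → ℝ} {M : ℝ}
    (hM : ∀ x, |φ x| ≤ M) (x : Space N) : |mollify ρ φ x| ≤ M := by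
  rw [mollify_eq, ← Real.norm_eq_abs]
  simpa using norm_integral_le_of_norm_le_const (μ := bumpMeasure ρ) (f := fun t => φ (x - t))
    (Eventually.of_forall fun t => hM (x - t))

lemma contDiff_mollify (ρ : ContDiffBump (0 : Space N)) {φ : Space N → ℝ} {M : ℝ}
    (hφm : Measurable φ) (hM : ∀ x, |φ x| ≤ M) : ContDiff ℝ ∞ (mollify ρ φ) :=
  ρ.hasCompactSupport_normed.contDiff_convolution_left _ ρ.contDiff_normed
    (locallyIntegrable_of_bounded hφm hM)

lemma mollify_eq_zero (ρ : ContDiffBump (0 : Space N)) {φ : Space N → ℝ} {K : Set (Space N)}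
    {δ : ℝ} (hδ : ρ.rOut ≤ δ) (hφ : ∀ x ∉ K, φ x = 0) :
    ∀ x ∉ Metric.cthickening δ K, mollify ρ φ x = 0 := by
  intro x hx
  rw [mollify_eq]
  refine integral_eq_zero_of_ae ?_
  filter_upwards [bumpMeasure_ae ρ] with t ht
  refine hφ _ fun h => hx (Metric.mem_cthickening_of_dist_le x (x - t) δ K h ?_)
  rw [dist_eq_norm, sub_sub_cancel]
  exact ht.le.trans hδ

/-- Mollification does not increase the Gagliardo energy, up to a shrinking of the domain. -/
lemma gagliardo_mollify_le (hp : 1 < p) (ρ : ContDiffBump (0 : Space N)) {φ : Space N → ℝ} {M : ℝ}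
    (hφm : Measurable φ) (hM : ∀ x, |φ x| ≤ M) {L L' : Set (Space N)} (hL : MeasurableSet L)
    (hL' : MeasurableSet L') (h : ∀ x ∈ L, ∀ t : Space N, ‖t‖ < ρ.rOut → x - t ∈ L') :
    gagliardo s p L (mollify ρ φ) ≤ gagliardo s p L' φ := by
  rw [gagliardo_eq hL, gagliardo_eq hL']
  have hbd : ∀ x y t : Space N, |φ (x - t) - φ (y - t)| ≤ 2 * M := fun x y t =>
    (abs_sub _ _).trans (by linarith [hM (x - t), hM (y - t)])
  have hjoint : Measurable fun w : (Space N × Space N) × Space N =>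
      |φ (w.1.1 - w.2) - φ (w.1.2 - w.2)| := by fun_prop
  have hsec : ∀ z : Space N × Space N, Measurable fun t => |φ (z.1 - t) - φ (z.2 - t)| :=
    fun z => hjoint.comp measurable_prodMk_left
  -- Jensen's inequality for the probability measure `bumpMeasure ρ`; exchanging the integrals and
  -- using translation invariance of the Gagliardo measure then gives the bound.
  have hjensen : ∀ z : Space N × Space N, ENNReal.ofReal (|pairDiff (mollify ρ φ) z| ^ p) ≤
      ∫⁻ t, ENNReal.ofReal (|φ (z.1 - t) - φ (z.2 - t)| ^ p) ∂bumpMeasure ρ := by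
    intro z
    have hi : ∀ x : Space N, Integrable (fun t => φ (x - t)) (bumpMeasure ρ) := fun x =>
      Integrable.of_bound
        (hφm.comp (measurable_const.sub measurable_id)).aestronglyMeasurable M (Eventually.of_forall fun t => hM _)
    have hi1 : Integrable (fun t => |φ (z.1 - t) - φ (z.2 - t)|) (bumpMeasure ρ) :=
      ((hi z.1).sub (hi z.2)).abs
    have hi2 : Integrable (fun t => |φ (z.1 - t) - φ (z.2 - t)| ^ p) (bumpMeasure ρ) := by
      refine Integrable.of_bound ((hsec z).pow_const p).aestronglyMeasurable ((2 * M) ^ p)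
        (Eventually.of_forall fun t => ?_)
      rw [Real.norm_eq_abs, abs_of_nonneg (by positivity)]
      exact Real.rpow_le_rpow (abs_nonneg _) (hbd _ _ _) (by linarith)
    rw [← ofReal_integral_eq_lintegral_ofReal hi2
      (Eventually.of_forall fun t => by dsimp; positivity)]
    refine ENNReal.ofReal_le_ofReal ?_
    have h1 : |pairDiff (mollify ρ φ) z| ≤
        ∫ t, |φ (z.1 - t) - φ (z.2 - t)| ∂bumpMeasure ρ := by
      rw [pairDiff, mollify_eq, mollify_eq, ← integral_sub (hi _) (hi _)]
      exact abs_integral_le_integral_abs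
    refine (Real.rpow_le_rpow (abs_nonneg _) h1 (by linarith)).trans ?_
    exact (convexOn_rpow hp.le).map_integral_le
      (Real.continuous_rpow_const (by linarith)).continuousOn isClosed_Ici
      (Eventually.of_forall fun t => mem_Ici.2 (abs_nonneg _)) hi1 hi2
  have hg : Measurable fun z => ENNReal.ofReal (|pairDiff φ z| ^ p) :=
    ((measurable_pairDiff hφm).abs.pow_const p).ennreal_ofReal
  calc _ ≤ ∫⁻ z in L ×ˢ L, ∫⁻ t, ENNReal.ofReal (|φ (z.1 - t) - φ (z.2 - t)| ^ p)
        ∂bumpMeasure ρ ∂gagliardoMeasure N s p := lintegral_mono hjensen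
    _ = ∫⁻ t, ∫⁻ z in L ×ˢ L, ENNReal.ofReal (|φ (z.1 - t) - φ (z.2 - t)| ^ p)
        ∂gagliardoMeasure N s p ∂bumpMeasure ρ := by
        have : SFinite (gagliardoMeasure N s p) := by rw [gagliardoMeasure]; infer_instance
        exact lintegral_lintegral_swap (hjoint.pow_const p).ennreal_ofReal.aemeasurable
    _ ≤ ∫⁻ _, ∫⁻ z in L' ×ˢ L', ENNReal.ofReal (|pairDiff φ z| ^ p)
        ∂gagliardoMeasure N s p ∂bumpMeasure ρ := by
        refine lintegral_mono_ae ?_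
        filter_upwards [bumpMeasure_ae ρ] with t ht
        rw [← lintegral_indicator (hL.prod hL), ← lintegral_indicator (hL'.prod hL'),
          ← lintegral_gagliardoMeasure_sub (hg.indicator (hL'.prod hL')) t]
        refine lintegral_mono fun z => ?_
        by_cases hz : z ∈ L ×ˢ L
        · have hz' : (z.1 - t, z.2 - t) ∈ L' ×ˢ L' := ⟨h _ hz.1 t ht, h _ hz.2 t ht⟩
          rw [indicator_of_mem hz, indicator_of_mem hz', pairDiff]
        · rw [indicator_of_notMem hz]; exact zero_le
    _ = _ := by simp

variable {γ : ℝ} {Ω : Set (Space N)} {f u : Space N → ℝ}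

lemma IsWeakSolution.lintegral_rpow_lt_top (hu : IsWeakSolution s p γ Ω f u) (hp : 1 < p)
    (hΩ : IsOpen Ω) (hu0 : ∀ x ∉ Ω, u x = 0) : ∫⁻ x, ENNReal.ofReal (|u x| ^ (p - 1)) < ⊤ := by
  have h := lintegral_rpow_enorm_lt_top_of_eLpNorm_lt_top
    (by simpa using hp) ENNReal.ofReal_ne_top hu.memLp.2
  rw [ENNReal.toReal_ofReal (by linarith), ← lintegral_indicator hΩ.measurableSet] at h
  refine lt_of_eq_of_lt (lintegral_congr fun x => ?_) h
  by_cases hx : x ∈ Ω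
  · rw [indicator_of_mem hx, Real.enorm_eq_ofReal_abs,
      ENNReal.ofReal_rpow_of_nonneg (abs_nonneg _) (by linarith)]
  · rw [indicator_of_notMem hx, hu0 x hx, abs_zero, Real.zero_rpow (by linarith),
      ENNReal.ofReal_zero]

/-- Weak solutions may be tested with bounded functions of finite local energy and compact
support. -/
theorem IsWeakSolution.weakForm_eq_of_bounded [NeZero N] (hs₀ : 0 < s) (hs₁ : s < 1) (hp : 1 < p)
    (hΩ : IsOpen Ω) (hu : IsWeakSolution s p γ Ω f u) (hum : Measurable u)
    (hu0 : ∀ x ∉ Ω, u x = 0) {φ : Space N → ℝ} (hφm : Measurable φ) {M : ℝ}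
    (hM : ∀ x, |φ x| ≤ M) {K : Set (Space N)} (hK : IsCompact K) (hKΩ : K ⊆ Ω)
    (hφ : ∀ x ∉ K, φ x = 0) (hφL : ∀ L, IsCompact L → L ⊆ Ω → gagliardo s p L φ < ⊤) :
    Integrable (fun z => oddPow p (pairDiff u z) * pairDiff φ z) (gagliardoMeasure N s p) ∧
      IntegrableOn (fun x => f x / u x ^ γ * φ x) Ω ∧
      weakForm s p u φ = ∫ x in Ω, f x / u x ^ γ * φ x := by
  obtain ⟨δ₀, hδ₀, hδΩ⟩ := hK.exists_cthickening_subset_open hΩ hKΩ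
  -- Three nested thickenings in Ω: radius δ holds the supports of all mollifications, radius 2δ is
  -- the set L separated from them by δ, and radius 3δ contains L shifted by at most δ, where the
  -- energy of φ bounds that of its mollifications on L.
  obtain ⟨δ, hδ, hδ3⟩ : ∃ δ, 0 < δ ∧ 3 * δ = δ₀ := ⟨δ₀ / 3, by positivity, by ring⟩
  have hsub : ∀ {r}, r ≤ 3 * δ → Metric.cthickening r K ⊆ Ω := fun hr =>
    (Metric.cthickening_mono (hr.trans hδ3.le) K).trans hδΩ
  have hadd : ∀ {r x y}, 0 ≤ r → x ∈ Metric.cthickening r K → ‖x - y‖ ≤ δ →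
      y ∈ Metric.cthickening (δ + r) K := fun {r x y} hr hx hxy => by
    refine Metric.cthickening_cthickening_subset hδ.le hr K
      (Metric.mem_cthickening_of_dist_le y x δ _ hx ?_)
    rwa [dist_comm, dist_eq_norm]
  set K₁ := Metric.cthickening δ K with hK₁
  set L := Metric.cthickening (2 * δ) K with hL
  have hK₁c : IsCompact K₁ := hK.cthickening
  have hLc : IsCompact L := hK.cthickening
  have hL'c : IsCompact (Metric.cthickening (3 * δ) K) := hK.cthickening
  have hK₁Ω : K₁ ⊆ Ω := hsub (by linarith)
  have hsep : ∀ x ∈ K₁, ∀ y ∉ L, δ ≤ ‖x - y‖ := fun x hx y hy => by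
    by_contra! hlt
    have := hadd hδ.le hx hlt.le
    rw [← two_mul] at this
    exact hy this
  have hφ₁ : ∀ x ∉ K₁, φ x = 0 := fun x hx =>
    hφ x fun h => hx (Metric.self_subset_cthickening K h)
  have hup := hu.lintegral_rpow_lt_top hp hΩ hu0
  have huL := (hu.memWloc L hLc (hsub (by linarith))).2
  have hφL₁ := hφL L hLc (hsub (by linarith))
  -- The constant ratio 2 of outer to inner radius makes the mollifications converge almost
  -- everywhere for merely locally integrable φ.
  let ρ : ℕ → ContDiffBump (0 : Space N) := fun n =>
    ⟨δ / (n + 1) / 2, δ / (n + 1), by positivity, half_lt_self (by positivity)⟩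
  have hρδ : ∀ n, (ρ n).rOut ≤ δ := fun n => div_le_self hδ.le (by simp)
  have hψm : ∀ n, Measurable (mollify (ρ n) φ) := fun n =>
    (contDiff_mollify (ρ n) hφm hM).continuous.measurable
  have hψ0 : ∀ n, ∀ x ∉ K₁, mollify (ρ n) φ x = 0 := fun n => mollify_eq_zero (ρ n) (hρδ n) hφ
  have hlim : ∀ᵐ x, Tendsto (fun n => mollify (ρ n) φ x) atTop (𝓝 (φ x)) := by
    refine ContDiffBump.ae_convolution_tendsto_right_of_locallyIntegrable (K := 2) ?_
      (Eventually.of_forall fun n => ?_) (locallyIntegrable_of_bounded hφm hM)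
    · exact tendsto_const_div_atTop_nhds_zero_nat δ |>.comp (tendsto_add_atTop_nat 1) |>.congr
        fun n => by simp [ρ]
    · change δ / (n + 1) ≤ 2 * (δ / (n + 1) / 2)
      linarith
  have htest : ∀ n, IsTestFunction Ω (mollify (ρ n) φ) := fun n => by
    have hts : tsupport (mollify (ρ n) φ) ⊆ K₁ :=
      closure_minimal (fun x hx => by_contra fun h => hx (hψ0 n x h)) hK₁c.isClosed
    exact ⟨contDiff_mollify (ρ n) hφm hM, hK₁c.of_isClosed_subset (isClosed_tsupport _) hts,
      hts.trans hK₁Ω⟩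
  have hgK : IntegrableOn (fun x => f x / u x ^ γ) K₁ :=
    hu.locallyIntegrable.integrableOn_compact_subset hK₁Ω hK₁c
  have hgm : AEStronglyMeasurable (fun x => f x / u x ^ γ) (volume.restrict Ω) :=
    hu.locallyIntegrable.aestronglyMeasurable
  have hdom : IntegrableOn (K₁.indicator fun x => |f x / u x ^ γ| * M) Ω :=
    ((integrable_indicator_iff hK₁c.measurableSet).2 (hgK.abs.mul_const M)).integrableOn
  have hle : ∀ ψ : Space N → ℝ, (∀ x, |ψ x| ≤ M) → (∀ x ∉ K₁, ψ x = 0) → ∀ x,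
      ‖f x / u x ^ γ * ψ x‖ ≤ K₁.indicator (fun x => |f x / u x ^ γ| * M) x := by
    intro ψ h1 h2 x
    by_cases hx : x ∈ K₁
    · rw [indicator_of_mem hx, Real.norm_eq_abs, abs_mul]
      exact mul_le_mul_of_nonneg_left (h1 x) (abs_nonneg _)
    · rw [indicator_of_notMem hx, h2 x hx, mul_zero, norm_zero]
  refine ⟨integrable_weakForm hs₀ hs₁ hp hum hφm hup hK₁c hLc hδ hsep hM hφ₁ huL hφL₁,
    hdom.mono' (hgm.mul hφm.aestronglyMeasurable) (Eventually.of_forall (hle φ hM hφ₁)), ?_⟩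
  have hleft := tendsto_weakForm hs₀ hs₁ hp hum hφm hψm hup hK₁c hLc hδ hsep hM hφ₁
    (fun n => abs_mollify_le (ρ n) hM) hψ0 huL hφL₁ (hφL _ hL'c (hsub le_rfl)) (fun n => by
      refine gagliardo_mollify_le hp (ρ n) hφm hM hLc.measurableSet hL'c.measurableSet
        fun x hx t ht => ?_
      have := hadd (y := x - t) (by positivity) hx (by
        rw [sub_sub_cancel]; exact ht.le.trans (hρδ n))
      rwa [show δ + 2 * δ = 3 * δ by ring] at this) hlim
  simp_rw [fun n => hu.weak_eq _ (htest n)] at hleft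
  refine tendsto_nhds_unique hleft (tendsto_integral_of_dominated_convergence _
    (fun n => hgm.mul (hψm n).aestronglyMeasurable) hdom
    (fun n => Eventually.of_forall (hle _ (abs_mollify_le (ρ n) hM) (hψ0 n))) ?_)
  filter_upwards [ae_restrict_of_ae hlim] with x hx using hx.const_mul _

end

/-! ### Exterior balls and the fractional Hardy inequality -/

section

variable {N : ℕ} {s p : ℝ} {Ω : Set (Space N)}

/-- Local form of the uniform exterior ball-in-cone property. -/
lemma IsSmoothBoundedDomain.exists_local_exterior_balls (hΩ : IsSmoothBoundedDomain Ω)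
    {x₀ : Space N} (hx₀ : x₀ ∈ frontier Ω) :
    ∃ V ∈ 𝓝 x₀, ∃ κ : ℝ, 0 < κ ∧ κ ≤ 1 ∧ ∃ r : ℝ, 0 < r ∧ ∀ z ∈ V, z ∉ Ω →
      ∀ t : ℝ, 0 < t → t ≤ r → ∃ y, ‖y - z‖ ≤ t ∧ Metric.ball y (κ * t) ⊆ Ωᶜ := by
  obtain ⟨U, hU, ρ, hρ, hA, hΩU⟩ := hΩ.smooth_boundary x₀ hx₀
  set A := fderiv ℝ ρ x₀ with hAdef
  obtain ⟨e, he1, he⟩ : ∃ e : Space N, ‖e‖ = 1 ∧ 0 < A e := by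
    obtain ⟨w, hw⟩ : ∃ w, A w ≠ 0 := by
      by_contra! h
      exact hA (ContinuousLinearMap.ext h)
    have hw0 : w ≠ 0 := fun h => hw (by simp [h])
    have hn : 0 < ‖w‖ := norm_pos_iff.2 hw0
    rcases lt_or_gt_of_ne hw with h | h
    · refine ⟨-(‖w‖⁻¹ • w), by simp [norm_smul, hn.ne'], ?_⟩
      rw [map_neg, map_smul, smul_eq_mul]
      have : 0 < ‖w‖⁻¹ := by positivity
      nlinarith
    · refine ⟨‖w‖⁻¹ • w, by simp [norm_smul, hn.ne'], ?_⟩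
      rw [map_smul, smul_eq_mul]
      positivity
  set a := A e with ha
  -- Strict differentiability makes the linear approximation uniform over both points near x₀, so
  -- that z may vary and need not be x₀.
  have hstrict : HasStrictFDerivAt ρ A x₀ := hρ.contDiffAt.hasStrictFDerivAt (by simp)
  have hlo := hstrict.isLittleO.def (show 0 < a / 4 by positivity)
  have hU' : ∀ᶠ q : Space N × Space N in 𝓝 (x₀, x₀), q.1 ∈ U ∧ q.2 ∈ U := by
    rw [nhds_prod_eq]; exact prod_mem_prod hU hU
  obtain ⟨R, hR, hball⟩ := Metric.eventually_nhds_iff_ball.1 (hlo.and hU')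
  have hB : ∀ x ∈ Metric.ball x₀ R, ∀ y ∈ Metric.ball x₀ R,
      |ρ x - ρ y - A (x - y)| ≤ a / 4 * ‖x - y‖ ∧ x ∈ U ∧ y ∈ U := fun x hx y hy => by
    have := hball (x, y) (by rw [← ball_prod_same]; exact ⟨hx, hy⟩)
    simpa [Real.norm_eq_abs] using this
  -- κ is chosen so that κ ≤ 1 and ‖A‖ κ ≤ a/4: perturbing the direction t e by less than κ t
  -- changes A by at most a t/4.
  have hκ : 0 < a / (4 * ‖A‖ + a) := by positivity
  have hκ1 : a / (4 * ‖A‖ + a) ≤ 1 := by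
    rw [div_le_one (by positivity)]
    linarith [norm_nonneg A]
  have hκA : ‖A‖ * (a / (4 * ‖A‖ + a)) ≤ a / 4 := by
    rw [← mul_div_assoc, div_le_div_iff₀ (by positivity) (by norm_num)]
    nlinarith [norm_nonneg A]
  set κ := a / (4 * ‖A‖ + a)
  refine ⟨Metric.ball x₀ (R / 2), Metric.ball_mem_nhds _ (by positivity), κ, hκ, hκ1, R / 4,
    by positivity, fun z hz hzΩ t ht htR => ⟨z + t • e, ?_, fun y hy hyΩ => ?_⟩⟩
  · simp [norm_smul, he1, abs_of_pos ht]
  · set h := y - (z + t • e) with hh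
    have hhn : ‖h‖ < κ * t := by rwa [← dist_eq_norm]
    have hyz : y - z = t • e + h := by rw [hh]; abel
    have hyzn : ‖y - z‖ ≤ t + κ * t := by
      rw [hyz]
      refine (norm_add_le _ _).trans (add_le_add ?_ hhn.le)
      simp [norm_smul, he1, abs_of_pos ht]
    have hκt : κ * t ≤ t := by nlinarith
    have hz' : z ∈ Metric.ball x₀ R := Metric.ball_subset_ball (by linarith) hz
    have hy' : y ∈ Metric.ball x₀ R := by
      rw [Metric.mem_ball] at hz ⊢
      calc dist y x₀ ≤ dist y z + dist z x₀ := dist_triangle _ _ _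
        _ < R := by rw [dist_eq_norm y z]; linarith
    obtain ⟨hest, hyU, hzU⟩ := hB y hy' z hz'
    have hρy : ρ y < 0 := by
      have : y ∈ Ω ∩ U := ⟨hyΩ, hyU⟩
      rw [hΩU] at this
      exact this.1
    have hρz : 0 ≤ ρ z := by
      by_contra! hneg
      have : z ∈ {x | ρ x < 0} ∩ U := ⟨hneg, hzU⟩
      rw [← hΩU] at this
      exact hzΩ this.1
    -- If y were in Ω, then ρ y < 0 ≤ ρ z. But ρ y - ρ z ≥ t a - t a/4 - t a/2 > 0, the losses
    -- coming from h and from the linearization error with ‖y - z‖ ≤ 2t.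
    have hAh : |A h| ≤ a / 4 * t := by
      calc |A h| ≤ ‖A‖ * ‖h‖ := A.le_opNorm h
        _ ≤ ‖A‖ * (κ * t) := by gcongr
        _ = ‖A‖ * κ * t := by ring
        _ ≤ a / 4 * t := by gcongr
    have hAyz : A (y - z) = t * a + A h := by rw [hyz, map_add, map_smul, smul_eq_mul, ha]
    have h1 : a / 4 * ‖y - z‖ ≤ a / 4 * (2 * t) := by gcongr; linarith
    have h2 := (abs_le.1 (hest.trans h1)).1
    have h3 := (abs_le.1 hAh).1
    have h4 : 0 < t * a := by positivity
    linarith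

/-- A smooth bounded domain has, at all boundary points and all small scales, a ball of comparable
size in its complement. -/
lemma IsSmoothBoundedDomain.exists_exterior_balls (hΩ : IsSmoothBoundedDomain Ω) :
    ∃ κ : ℝ, 0 < κ ∧ κ ≤ 1 ∧ ∃ r : ℝ, 0 < r ∧ ∀ z ∈ frontier Ω,
      ∀ t : ℝ, 0 < t → t ≤ r → ∃ y, ‖y - z‖ ≤ t ∧ Metric.ball y (κ * t) ⊆ Ωᶜ := by
  have hc : IsCompact (frontier Ω) := Metric.isCompact_of_isClosed_isBounded isClosed_frontier
    (hΩ.isBounded.closure.subset frontier_subset_closure)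
  refine hc.induction_on (p := fun S => ∃ κ : ℝ, 0 < κ ∧ κ ≤ 1 ∧ ∃ r : ℝ, 0 < r ∧ ∀ z ∈ S,
      ∀ t : ℝ, 0 < t → t ≤ r → ∃ y, ‖y - z‖ ≤ t ∧ Metric.ball y (κ * t) ⊆ Ωᶜ) ?_ ?_ ?_ ?_
  · exact ⟨1, one_pos, le_rfl, 1, one_pos, fun z hz => absurd hz (notMem_empty z)⟩
  · rintro S T hST ⟨κ, h1, h2, r, h3, h4⟩
    exact ⟨κ, h1, h2, r, h3, fun z hz => h4 z (hST hz)⟩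
  · rintro S T ⟨κ, h1, h2, r, h3, h4⟩ ⟨κ', h1', h2', r', h3', h4'⟩
    refine ⟨min κ κ', lt_min h1 h1', (min_le_left _ _).trans h2, min r r', lt_min h3 h3', ?_⟩
    rintro z (hz | hz) t ht htr
    · obtain ⟨y, hy1, hy2⟩ := h4 z hz t ht (htr.trans (min_le_left _ _))
      exact ⟨y, hy1, (Metric.ball_subset_ball (by gcongr; exact min_le_left _ _)).trans hy2⟩
    · obtain ⟨y, hy1, hy2⟩ := h4' z hz t ht (htr.trans (min_le_right _ _))
      exact ⟨y, hy1, (Metric.ball_subset_ball (by gcongr; exact min_le_right _ _)).trans hy2⟩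
  · intro x hx
    obtain ⟨V, hV, κ, h1, h2, r, h3, h4⟩ := hΩ.exists_local_exterior_balls hx
    refine ⟨V ∩ frontier Ω, inter_mem (mem_nhdsWithin_of_mem_nhds hV) self_mem_nhdsWithin,
      κ, h1, h2, r, h3, fun z hz => h4 z hz.1 ?_⟩
    have := hz.2
    rw [hΩ.isOpen.frontier_eq] at this
    exact this.2

/-- The distance to the complement of `Ω`. -/
noncomputable def distCompl (Ω : Set (Space N)) (x : Space N) : ℝ := Metric.infDist x Ωᶜ

lemma distCompl_nonneg (x : Space N) : 0 ≤ distCompl Ω x := Metric.infDist_nonneg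

lemma continuous_distCompl : Continuous (distCompl Ω) := Metric.continuous_infDist_pt _

lemma abs_distCompl_sub_le (x y : Space N) : |distCompl Ω x - distCompl Ω y| ≤ ‖x - y‖ := by
  have := (Metric.lipschitz_infDist_pt Ωᶜ).dist_le_mul x y
  simpa [Real.dist_eq, dist_eq_norm, distCompl] using this

lemma distCompl_of_notMem {x : Space N} (hx : x ∉ Ω) : distCompl Ω x = 0 :=
  Metric.infDist_zero_of_mem hx

lemma volume_compl_eq_top [NeZero N] (hΩ : Bornology.IsBounded Ω) (hm : MeasurableSet Ω) :
    volume Ωᶜ = ⊤ := by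
  have : Nonempty (Fin N) := ⟨0⟩
  rw [measure_compl hm hΩ.measure_lt_top.ne, measure_univ_of_isAddLeftInvariant]
  exact ENNReal.top_sub hΩ.measure_lt_top.ne

lemma IsSmoothBoundedDomain.compl_nonempty [NeZero N] (hΩ : IsSmoothBoundedDomain Ω) :
    Ωᶜ.Nonempty :=
  nonempty_of_measure_ne_zero (μ := volume)
    (by simp [volume_compl_eq_top hΩ.isBounded hΩ.isOpen.measurableSet])

lemma IsSmoothBoundedDomain.distCompl_pos [NeZero N] (hΩ : IsSmoothBoundedDomain Ω) {x : Space N}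
    (hx : x ∈ Ω) : 0 < distCompl Ω x :=
  (hΩ.isOpen.isClosed_compl.notMem_iff_infDist_pos hΩ.compl_nonempty).1 (fun h => h hx)

/-- Lower bound for the interaction of a point of `Ω` with the complement. -/
lemma IsSmoothBoundedDomain.exists_le_lintegral_compl_kernel [NeZero N]
    (hΩ : IsSmoothBoundedDomain Ω) (hsp : 0 < s * p) :
    ∃ c : ENNReal, c ≠ 0 ∧ ∀ x ∈ Ω, c * ENNReal.ofReal (distCompl Ω x ^ (-(s * p))) ≤
      ∫⁻ y in Ωᶜ, ENNReal.ofReal (1 / ‖x - y‖ ^ ((N : ℝ) + s * p)) := by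
  have : Nonempty (Fin N) := ⟨0⟩
  obtain ⟨κ, hκ, hκ1, r, hr, hball⟩ := hΩ.exists_exterior_balls
  set D := Metric.diam (closure Ω) + 1 with hD
  have hDpos : 0 < D := by have := Metric.diam_nonneg (s := closure Ω); linarith
  -- Exterior balls exist only at scales up to r; shrinking by l keeps the scale l d below r for
  -- every distance d ≤ D. Points of the resulting ball are within d + l d + κ l d ≤ 3d of x, so it
  -- contributes a multiple of d^N · d^{-(N+sp)} = d^{-sp}.
  set l := min 1 (r / D) with hl
  have hlpos : 0 < l := lt_min one_pos (by positivity)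
  have hl1 : l ≤ 1 := min_le_left _ _
  have hlD : l * D ≤ r := by
    calc l * D ≤ r / D * D := by gcongr; exact min_le_right _ _
      _ = r := by field_simp
  refine ⟨ENNReal.ofReal ((κ * l) ^ N / 3 ^ ((N : ℝ) + s * p)) *
    volume (Metric.ball (0 : Space N) 1), ?_, fun x hx => ?_⟩
  · refine mul_ne_zero ?_ (Metric.measure_ball_pos _ _ one_pos).ne'
    rw [ENNReal.ofReal_ne_zero_iff]
    positivity
  have hd : 0 < distCompl Ω x := hΩ.distCompl_pos hx
  obtain ⟨z, hz, hxz⟩ := exists_mem_frontier_infDist_compl_eq_dist hx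
    (nonempty_compl.1 hΩ.compl_nonempty)
  change distCompl Ω x = dist x z at hxz
  set d := distCompl Ω x
  have hdD : d ≤ D := by
    have := Metric.dist_le_diam_of_mem hΩ.isBounded.closure (subset_closure hx)
      (frontier_subset_closure hz)
    linarith
  obtain ⟨y₀, hy₀, hsub⟩ := hball z hz (l * d) (by positivity)
    ((mul_le_mul_of_nonneg_left hdD hlpos.le).trans hlD)
  have hfar : ∀ y ∈ Metric.ball y₀ (κ * (l * d)), ‖x - y‖ ≤ 3 * d := fun y hy => by
    rw [Metric.mem_ball] at hy
    rw [← dist_eq_norm] at hy₀ ⊢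
    have h1 : l * d ≤ d := by nlinarith
    have h2 : κ * (l * d) ≤ l * d := by
      have : 0 < l * d := by positivity
      nlinarith
    have h3 := dist_triangle x z y
    have h4 := dist_triangle z y₀ y
    rw [dist_comm z y₀, dist_comm y₀ y] at h4
    linarith
  have hkey : ∀ y ∈ Metric.ball y₀ (κ * (l * d)), ENNReal.ofReal (1 / (3 * d) ^ ((N : ℝ) + s * p)) ≤
      ENNReal.ofReal (1 / ‖x - y‖ ^ ((N : ℝ) + s * p)) := fun y hy => by
    have hne : 0 < ‖x - y‖ := norm_pos_iff.2 (sub_ne_zero.2 fun h => hsub hy (h ▸ hx))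
    refine ENNReal.ofReal_le_ofReal (one_div_le_one_div_of_le (by positivity) ?_)
    exact Real.rpow_le_rpow hne.le (hfar y hy) (by positivity)
  calc _ = ENNReal.ofReal (1 / (3 * d) ^ ((N : ℝ) + s * p)) *
        volume (Metric.ball y₀ (κ * (l * d))) := by
        rw [Measure.addHaar_ball _ y₀ (by positivity), finrank_euclideanSpace_fin, mul_right_comm,
          ← mul_assoc, ← ENNReal.ofReal_mul (by positivity), ← ENNReal.ofReal_mul (by positivity)]
        congr 2
        rw [Real.mul_rpow (by norm_num) hd.le, Real.rpow_add hd, Real.rpow_natCast,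
          Real.rpow_neg hd.le, ← mul_assoc κ, mul_pow (κ * l)]
        have : 0 < d ^ (s * p) := by positivity
        field_simp
    _ = ∫⁻ _ in Metric.ball y₀ (κ * (l * d)),
          ENNReal.ofReal (1 / (3 * d) ^ ((N : ℝ) + s * p)) := by
        rw [setLIntegral_const]
    _ ≤ ∫⁻ y in Metric.ball y₀ (κ * (l * d)),
          ENNReal.ofReal (1 / ‖x - y‖ ^ ((N : ℝ) + s * p)) :=
        setLIntegral_mono' measurableSet_ball hkey
    _ ≤ _ := lintegral_mono_set hsub

/-- The fractional Hardy inequality for functions vanishing outside a smooth bounded domain, in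
qualitative form. -/
lemma IsSmoothBoundedDomain.hardy [NeZero N] (hΩ : IsSmoothBoundedDomain Ω) (hs₀ : 0 < s)
    (hp : 1 < p) {w : Space N → ℝ} (hwm : Measurable w) (hw0 : ∀ x ∉ Ω, w x = 0)
    (hw : gagliardo s p univ w < ⊤) :
    ∫⁻ x, ENNReal.ofReal (|w x| ^ p) * ENNReal.ofReal (distCompl Ω x ^ (-(s * p))) < ⊤ := by
  obtain ⟨c, hc0, hc⟩ := hΩ.exists_le_lintegral_compl_kernel (s := s) (p := p) (by positivity)
  rw [gagliardo_eq MeasurableSet.univ, univ_prod_univ, Measure.restrict_univ,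
    lintegral_gagliardoMeasure ((measurable_pairDiff hwm).abs.pow_const p).ennreal_ofReal] at hw
  have hle : c * ∫⁻ x, ENNReal.ofReal (|w x| ^ p) *
      ENNReal.ofReal (distCompl Ω x ^ (-(s * p))) < ⊤ := by
    rw [← lintegral_const_mul _ (by
      have := (continuous_distCompl (Ω := Ω)).measurable
      fun_prop)]
    refine lt_of_le_of_lt (lintegral_mono fun x => ?_) hw
    -- Only the pairs in Ω × Ωᶜ are kept: there w y = 0, so the increment is w x and the kernel
    -- integrates to at least c d(x)^{-sp}.
    by_cases hx : x ∈ Ω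
    · calc c * (ENNReal.ofReal (|w x| ^ p) * ENNReal.ofReal (distCompl Ω x ^ (-(s * p))))
          = (c * ENNReal.ofReal (distCompl Ω x ^ (-(s * p)))) * ENNReal.ofReal (|w x| ^ p) := by
            ring
        _ ≤ (∫⁻ y in Ωᶜ, ENNReal.ofReal (1 / ‖x - y‖ ^ ((N : ℝ) + s * p))) *
            ENNReal.ofReal (|w x| ^ p) := by gcongr; exact hc x hx
        _ = ∫⁻ y in Ωᶜ, ENNReal.ofReal (1 / ‖x - y‖ ^ ((N : ℝ) + s * p)) *
            ENNReal.ofReal (|w x| ^ p) := (lintegral_mul_const' _ _ ENNReal.ofReal_ne_top).symm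
        _ = ∫⁻ y in Ωᶜ, ENNReal.ofReal (1 / ‖x - y‖ ^ ((N : ℝ) + s * p)) *
            ENNReal.ofReal (|pairDiff w (x, y)| ^ p) := by
            refine setLIntegral_congr_fun hΩ.isOpen.measurableSet.compl fun y hy => ?_
            simp only [pairDiff, hw0 y hy, sub_zero]
        _ ≤ _ := setLIntegral_le_lintegral _ _
    · rw [hw0 x hx, abs_zero, Real.zero_rpow (by linarith), ENNReal.ofReal_zero, zero_mul, mul_zero]
      exact zero_le
  by_contra! htop
  rw [top_le_iff] at htop
  rw [htop, ENNReal.mul_top hc0] at hle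
  exact lt_irrefl _ hle

end

/-! ### Cutoffs and truncations with a common majorant -/

section

variable {N : ℕ} {s p : ℝ} {Ω : Set (Space N)}

/-- The Lipschitz cutoff vanishing within distance `1 / (n + 1)` of the complement of `Ω`. -/
noncomputable def cutoff (Ω : Set (Space N)) (n : ℕ) (x : Space N) : ℝ :=
  max 0 (min 1 ((n + 1) * distCompl Ω x - 1))

lemma cutoff_nonneg (n : ℕ) (x : Space N) : 0 ≤ cutoff Ω n x := le_max_left _ _

lemma cutoff_le_one (n : ℕ) (x : Space N) : cutoff Ω n x ≤ 1 :=
  max_le zero_le_one (min_le_left _ _)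

lemma continuous_cutoff (n : ℕ) : Continuous (cutoff Ω n) :=
  continuous_const.max (continuous_const.min
    ((continuous_const.mul continuous_distCompl).sub continuous_const))

lemma abs_clamp_sub_le (a b : ℝ) : |max 0 (min 1 a) - max 0 (min 1 b)| ≤ |a - b| :=
  (abs_max_sub_max_le_max _ _ _ _).trans (max_le (by simp)
    ((abs_min_sub_min_le_max _ _ _ _).trans (max_le (by simp) le_rfl)))

/-- The oscillation of the cutoffs is scale invariant, uniformly in the cutoff parameter. -/
lemma abs_cutoff_sub_le (n : ℕ) {x : Space N} (hx : 0 < distCompl Ω x) (y : Space N) :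
    |cutoff Ω n x - cutoff Ω n y| ≤ min 1 (‖x - y‖ / (distCompl Ω x / 3)) := by
  have hn : (0 : ℝ) < n + 1 := by positivity
  have hxy := abs_distCompl_sub_le (Ω := Ω) x y
  refine le_min ?_ ?_
  · rw [abs_le]
    constructor <;> linarith [cutoff_nonneg (Ω := Ω) n x, cutoff_nonneg (Ω := Ω) n y,
      cutoff_le_one (Ω := Ω) n x, cutoff_le_one (Ω := Ω) n y]
  rw [le_div_iff₀ (by positivity)]
  -- Near the boundary the Lipschitz constant n + 1 is at most 3/d(x). Further inside the cutoff is
  -- 1 at x, and it can differ from 1 at y only if (n + 1) d(y) < 2; then d(y) < (2/3) d(x), so ‖x -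
  -- y‖ ≥ d(x)/3 and the trivial bound 1 suffices.
  rcases le_or_gt ((n + 1) * distCompl Ω x) 3 with h | h
  · have h1 : |cutoff Ω n x - cutoff Ω n y| ≤ (n + 1) * ‖x - y‖ := by
      refine (abs_clamp_sub_le _ _).trans ?_
      rw [sub_sub_sub_cancel_right, ← mul_sub, abs_mul, abs_of_pos hn]
      gcongr
    calc _ ≤ (n + 1) * ‖x - y‖ * (distCompl Ω x / 3) := by gcongr
      _ = ((n + 1) * distCompl Ω x) / 3 * ‖x - y‖ := by ring
      _ ≤ 1 * ‖x - y‖ := by gcongr; linarith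
      _ = _ := one_mul _
  · have hx1 : cutoff Ω n x = 1 := by
      rw [cutoff, min_eq_left (by linarith), max_eq_right zero_le_one]
    rcases le_or_gt 2 ((n + 1) * distCompl Ω y) with h' | h'
    · have hy1 : cutoff Ω n y = 1 := by
        rw [cutoff, min_eq_left (by linarith), max_eq_right zero_le_one]
      rw [hx1, hy1, sub_self, abs_zero, zero_mul]
      exact norm_nonneg _
    · have h1 : distCompl Ω x - distCompl Ω y ≤ ‖x - y‖ := (le_abs_self _).trans hxy
      have h2 : distCompl Ω y < 2 / 3 * distCompl Ω x := by nlinarith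
      have h3 : |cutoff Ω n x - cutoff Ω n y| ≤ 1 := by
        rw [abs_le]
        constructor <;> linarith [cutoff_nonneg (Ω := Ω) n x, cutoff_nonneg (Ω := Ω) n y,
          cutoff_le_one (Ω := Ω) n x, cutoff_le_one (Ω := Ω) n y]
      calc _ ≤ 1 * (distCompl Ω x / 3) := by gcongr
        _ ≤ _ := by linarith

/-- The closed set on which the cutoff may be nonzero. -/
def cutoffSupport (Ω : Set (Space N)) (n : ℕ) : Set (Space N) := {x | 1 ≤ (n + 1) * distCompl Ω x}

lemma cutoffSupport_subset (n : ℕ) : cutoffSupport Ω n ⊆ Ω := fun x hx => by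
  by_contra h
  have h1 : 1 ≤ ((n : ℝ) + 1) * distCompl Ω x := hx
  rw [distCompl_of_notMem h] at h1
  norm_num at h1

lemma isCompact_cutoffSupport (hΩ : Bornology.IsBounded Ω) (n : ℕ) :
    IsCompact (cutoffSupport Ω n) :=
  Metric.isCompact_of_isClosed_isBounded
    (isClosed_le continuous_const (continuous_const.mul continuous_distCompl))
    (hΩ.subset (cutoffSupport_subset n))

lemma cutoff_eq_zero {n : ℕ} {x : Space N} (hx : x ∉ cutoffSupport Ω n) : cutoff Ω n x = 0 := by
  have h : ((n : ℝ) + 1) * distCompl Ω x < 1 := not_le.1 hx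
  rw [cutoff, max_eq_left]
  exact (min_le_right _ _).trans (by linarith)

lemma eventually_cutoff_eq_one {x : Space N} (hx : 0 < distCompl Ω x) :
    ∀ᶠ n in atTop, cutoff Ω n x = 1 := by
  obtain ⟨m, hm⟩ := exists_nat_gt (2 / distCompl Ω x)
  filter_upwards [eventually_ge_atTop m] with n hn
  rw [div_lt_iff₀ hx] at hm
  have : (m : ℝ) ≤ n := by exact_mod_cast hn
  have : (m : ℝ) * distCompl Ω x ≤ n * distCompl Ω x := by gcongr
  rw [cutoff, min_eq_left (by linarith), max_eq_right zero_le_one]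

/-- Compactly supported bounded approximation of a nonnegative function. -/
noncomputable def truncation (Ω : Set (Space N)) (w : Space N → ℝ) (n : ℕ) (x : Space N) : ℝ :=
  cutoff Ω n x * min (w x) n

/-- The common majorant of the differences of the truncations. -/
noncomputable def truncationMajorant (Ω : Set (Space N)) (w : Space N → ℝ)
    (z : Space N × Space N) : ℝ :=
  |pairDiff w z| + |w z.1| * min 1 (‖z.1 - z.2‖ / (distCompl Ω z.1 / 3))

lemma truncationMajorant_nonneg (w : Space N → ℝ) (z : Space N × Space N) :
    0 ≤ truncationMajorant Ω w z := by
  have : 0 ≤ ‖z.1 - z.2‖ / (distCompl Ω z.1 / 3) :=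
    div_nonneg (norm_nonneg _) (div_nonneg (distCompl_nonneg _) (by norm_num))
  have : 0 ≤ min 1 (‖z.1 - z.2‖ / (distCompl Ω z.1 / 3)) := le_min zero_le_one this
  unfold truncationMajorant
  positivity

lemma measurable_truncation {w : Space N → ℝ} (hw : Measurable w) (n : ℕ) :
    Measurable (truncation Ω w n) :=
  (continuous_cutoff n).measurable.mul (hw.min measurable_const)

lemma measurable_truncationMajorant {w : Space N → ℝ} (hw : Measurable w) :
    Measurable (truncationMajorant Ω w) := by
  have := (continuous_distCompl (Ω := Ω)).measurable
  have := measurable_pairDiff hw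
  unfold truncationMajorant
  fun_prop

lemma truncation_nonneg {w : Space N → ℝ} (hw : ∀ x, 0 ≤ w x) (n : ℕ) (x : Space N) :
    0 ≤ truncation Ω w n x :=
  mul_nonneg (cutoff_nonneg n x) (le_min (hw x) (Nat.cast_nonneg n))

lemma truncation_le {w : Space N → ℝ} (hw : ∀ x, 0 ≤ w x) (n : ℕ) (x : Space N) :
    truncation Ω w n x ≤ w x :=
  (mul_le_of_le_one_left (le_min (hw x) (Nat.cast_nonneg n)) (cutoff_le_one n x)).trans
    (min_le_left _ _)

lemma truncation_le_natCast {w : Space N → ℝ} (hw : ∀ x, 0 ≤ w x) (n : ℕ) (x : Space N) :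
    truncation Ω w n x ≤ n :=
  (mul_le_of_le_one_left (le_min (hw x) (Nat.cast_nonneg n)) (cutoff_le_one n x)).trans
    (min_le_right _ _)

variable [NeZero N]

lemma tendsto_truncation (hΩ : IsSmoothBoundedDomain Ω) {w : Space N → ℝ}
    (hw0 : ∀ x ∉ Ω, w x = 0) (x : Space N) :
    Tendsto (fun n => truncation Ω w n x) atTop (𝓝 (w x)) := by
  by_cases hx : x ∈ Ω
  · obtain ⟨m, hm⟩ := exists_nat_ge (w x)
    refine tendsto_const_nhds.congr' ?_
    filter_upwards [eventually_cutoff_eq_one (hΩ.distCompl_pos hx), eventually_ge_atTop m]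
      with n h1 h2
    have : (m : ℝ) ≤ n := by exact_mod_cast h2
    rw [truncation, h1, one_mul, min_eq_left (hm.trans this)]
  · refine tendsto_const_nhds.congr fun n => ?_
    rw [truncation, cutoff_eq_zero (fun h => hx (cutoffSupport_subset n h)), zero_mul, hw0 x hx]

/-- A discrete product rule, with min(·, n) 1-Lipschitz and the cutoff at most 1. Scale invariance
of the cutoffs removes n from the bound. -/
lemma abs_pairDiff_truncation_le (hΩ : IsSmoothBoundedDomain Ω) {w : Space N → ℝ}
    (hw : ∀ x, 0 ≤ w x) (hw0 : ∀ x ∉ Ω, w x = 0) (n : ℕ) (z : Space N × Space N) :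
    |pairDiff (truncation Ω w n) z| ≤ truncationMajorant Ω w z := by
  obtain ⟨x, y⟩ := z
  have hdec : pairDiff (truncation Ω w n) (x, y) =
      cutoff Ω n y * (min (w x) n - min (w y) n) +
        min (w x) n * (cutoff Ω n x - cutoff Ω n y) := by
    simp only [pairDiff, truncation]; ring
  rw [hdec, truncationMajorant]
  refine (abs_add_le _ _).trans (add_le_add ?_ ?_)
  · rw [abs_mul, abs_of_nonneg (cutoff_nonneg n y)]
    refine (mul_le_of_le_one_left (abs_nonneg _) (cutoff_le_one n y)).trans ?_
    exact (abs_min_sub_min_le_max _ _ _ _).trans (max_le le_rfl (by simp))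
  · have h0 : 0 ≤ min (w x) n := le_min (hw x) (Nat.cast_nonneg n)
    rw [abs_mul, abs_of_nonneg h0, abs_of_nonneg (hw x)]
    by_cases hx : x ∈ Ω
    · exact mul_le_mul (min_le_left _ _) (abs_cutoff_sub_le n (hΩ.distCompl_pos hx) y)
        (abs_nonneg _) (hw x)
    · rw [hw0 x hx, min_eq_left (Nat.cast_nonneg n)]
      simp

/-- Integrating in y first, the truncated kernel at scale d(x)/3 yields a multiple of d(x)^{-sp};
what remains is the Hardy integral of w. -/
lemma lintegral_truncationMajorant_lt_top (hΩ : IsSmoothBoundedDomain Ω) (hs₀ : 0 < s)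
    (hs₁ : s < 1) (hp : 1 < p) {w : Space N → ℝ} (hwm : Measurable w)
    (hw0 : ∀ x ∉ Ω, w x = 0) (hw : gagliardo s p univ w < ⊤) :
    ∫⁻ z, ENNReal.ofReal (truncationMajorant Ω w z ^ p) ∂gagliardoMeasure N s p < ⊤ := by
  have hdm := (continuous_distCompl (Ω := Ω)).measurable
  have hpos : ∀ z : Space N × Space N,
      0 ≤ |w z.1| * min 1 (‖z.1 - z.2‖ / (distCompl Ω z.1 / 3)) := fun z =>
    mul_nonneg (abs_nonneg _) (le_min zero_le_one
      (div_nonneg (norm_nonneg _) (div_nonneg (distCompl_nonneg _) (by norm_num))))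
  refine lt_of_le_of_lt (lintegral_add_rpow_le (by linarith) (fun _ => abs_nonneg _) hpos
    (measurable_pairDiff hwm).abs (truncationMajorant_nonneg w) (fun z => le_rfl)) ?_
  refine ENNReal.mul_lt_top ENNReal.ofReal_lt_top (ENNReal.add_lt_top.2 ⟨?_, ?_⟩)
  · rwa [gagliardo_eq MeasurableSet.univ, univ_prod_univ, Measure.restrict_univ] at hw
  · rw [lintegral_gagliardoMeasure (by fun_prop)]
    obtain ⟨C, hC, hker⟩ := exists_lintegral_truncated_kernel (N := N) hs₀ hs₁ hp
    have hbound : ∀ x : Space N, ∫⁻ y, ENNReal.ofReal (1 / ‖x - y‖ ^ ((N : ℝ) + s * p)) *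
        ENNReal.ofReal ((|w x| * min 1 (‖x - y‖ / (distCompl Ω x / 3))) ^ p) ≤
        C * ENNReal.ofReal (3 ^ (s * p)) *
          (ENNReal.ofReal (|w x| ^ p) * ENNReal.ofReal (distCompl Ω x ^ (-(s * p)))) := by
      intro x
      by_cases hx : x ∈ Ω
      · have hd := hΩ.distCompl_pos hx
        calc _ = ∫⁻ y, ENNReal.ofReal (|w x| ^ p) *
              ENNReal.ofReal (min 1 (‖x - y‖ / (distCompl Ω x / 3)) ^ p /
                ‖x - y‖ ^ ((N : ℝ) + s * p)) := by
              refine lintegral_congr fun y => ?_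
              rw [← ENNReal.ofReal_mul (by positivity), ← ENNReal.ofReal_mul (by positivity),
                Real.mul_rpow (abs_nonneg _) (by positivity)]
              congr 1; ring
          _ = ENNReal.ofReal (|w x| ^ p) *
              ∫⁻ y : Space N, ENNReal.ofReal (min 1 (‖y‖ / (distCompl Ω x / 3)) ^ p /
                ‖y‖ ^ ((N : ℝ) + s * p)) := by
              rw [lintegral_const_mul' _ _ ENNReal.ofReal_ne_top]
              congr 1
              exact lintegral_sub_left_eq_self (fun y : Space N =>
                ENNReal.ofReal (min 1 (‖y‖ / (distCompl Ω x / 3)) ^ p /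
                ‖y‖ ^ ((N : ℝ) + s * p))) x
          _ ≤ ENNReal.ofReal (|w x| ^ p) *
              (C * ENNReal.ofReal ((distCompl Ω x / 3) ^ (-(s * p)))) := by
              gcongr
              exact hker _ (by positivity)
          _ = _ := by
              rw [Real.div_rpow hd.le (by norm_num), Real.rpow_neg (x := 3) (by norm_num),
                div_inv_eq_mul, mul_comm (distCompl Ω x ^ _), ENNReal.ofReal_mul (by positivity)]
              ring
      · rw [hw0 x hx]
        simp [Real.zero_rpow (by linarith : p ≠ 0)]
    refine lt_of_le_of_lt (lintegral_mono hbound) ?_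
    rw [lintegral_const_mul _ (by fun_prop)]
    exact ENNReal.mul_lt_top (ENNReal.mul_lt_top hC.lt_top ENNReal.ofReal_lt_top)
      (hΩ.hardy hs₀ hp hwm hw0 hw)

end

section

variable {N : ℕ} {s p γ : ℝ} {Ω : Set (Space N)} {f u v : Space N → ℝ}

/-! ### Reduction to measurable representatives -/

lemma gagliardo_congr {A : Set (Space N)} (h : u =ᵐ[volume] v) :
    gagliardo s p A u = gagliardo s p A v := by
  refine lintegral_congr_ae (ae_restrict_of_ae ?_)
  filter_upwards [ae_prod_of_ae h] with z hz
  rw [hz.1, hz.2]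

lemma IsWeakSolution.congr (hu : IsWeakSolution s p γ Ω f u) (h : u =ᵐ[volume] v) :
    IsWeakSolution s p γ Ω f v where
  memWloc K hK hKΩ := by
    obtain ⟨h1, h2⟩ := hu.memWloc K hK hKΩ
    exact ⟨h1.ae_eq (ae_restrict_of_ae h), by rwa [← gagliardo_congr h]⟩
  memLp := hu.memLp.ae_eq (ae_restrict_of_ae h)
  pos := by
    filter_upwards [hu.pos, ae_restrict_of_ae h] with x h1 h2
    rwa [← h2]
  vanishesOutside := by
    filter_upwards [hu.vanishesOutside, h] with x h1 h2 hx
    rw [← h2, h1 hx]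
  locallyIntegrable x hx := by
    obtain ⟨U, hU, hint⟩ := hu.locallyIntegrable x hx
    refine ⟨U, hU, hint.congr (ae_restrict_of_ae ?_)⟩
    filter_upwards [h] with y hy
    rw [hy]
  weak_eq φ hφ := by
    have h1 : weakForm s p v φ = weakForm s p u φ := by
      refine integral_congr_ae ?_
      filter_upwards [ae_prod_of_ae h] with z hz
      rw [hz.1, hz.2]
    rw [h1, hu.weak_eq φ hφ]
    refine integral_congr_ae (ae_restrict_of_ae ?_)
    filter_upwards [h] with y hy
    rw [hy]

/-- Absolute value and indicator turn the sign and the exterior condition into pointwise facts, so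
the comparison argument can avoid exceptional sets. -/
lemma IsWeakSolution.exists_measurable_representative (hu : IsWeakSolution s p γ Ω f u)
    (hΩ : IsOpen Ω) :
    ∃ u' : Space N → ℝ, Measurable u' ∧ (∀ x, 0 ≤ u' x) ∧ (∀ x ∉ Ω, u' x = 0) ∧
      u =ᵐ[volume] u' := by
  obtain ⟨g, hg, hug⟩ := hu.memLp.1
  refine ⟨Ω.indicator fun x => |g x|, hg.measurable.abs.indicator hΩ.measurableSet,
    fun x => indicator_nonneg (fun _ _ => abs_nonneg _) x, fun x hx => indicator_of_notMem hx _, ?_⟩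
  have h1 := (ae_restrict_iff' hΩ.measurableSet).1 hug
  have h2 := (ae_restrict_iff' hΩ.measurableSet).1 hu.pos
  filter_upwards [h1, h2, hu.vanishesOutside] with x h1 h2 h3
  by_cases hx : x ∈ Ω
  · rw [indicator_of_mem hx, ← h1 hx, abs_of_pos (h2 hx)]
  · rw [indicator_of_notMem hx, h3 hx]

/-! ### Comparison -/

/-- Together with its mirror image below: the increment of (a - b)^+ lies between 0 and that of a -
b, which is what `oddPow_sub_mul_nonneg` and `abs_rpow_le_absorb` require. -/
lemma pairDiff_max_sub_le {a b : Space N → ℝ} {z : Space N × Space N}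
    (h : 0 < pairDiff (fun x => max (a x - b x) 0) z) :
    pairDiff (fun x => max (a x - b x) 0) z ≤ pairDiff a z - pairDiff b z := by
  simp only [pairDiff] at h ⊢
  have h1 : 0 < max (a z.1 - b z.1) 0 := by linarith [le_max_right (a z.2 - b z.2) 0]
  have h2 : max (a z.1 - b z.1) 0 = a z.1 - b z.1 := by
    rcases le_total (a z.1 - b z.1) 0 with h3 | h3
    · rw [max_eq_right h3] at h1; exact absurd h1 (lt_irrefl _)
    · exact max_eq_left h3
  rw [h2]
  linarith [le_max_left (a z.2 - b z.2) 0]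

lemma le_pairDiff_max_sub {a b : Space N → ℝ} {z : Space N × Space N}
    (h : pairDiff (fun x => max (a x - b x) 0) z < 0) :
    pairDiff a z - pairDiff b z ≤ pairDiff (fun x => max (a x - b x) 0) z := by
  have hs : ∀ g : Space N → ℝ, pairDiff g z.swap = -pairDiff g z := fun g => by simp [pairDiff]
  have := pairDiff_max_sub_le (a := a) (b := b) (z := z.swap) (by rw [hs]; linarith)
  simp only [hs] at this
  linarith

lemma abs_pairDiff_max_sub_le (a b : Space N → ℝ) (z : Space N × Space N) :
    |pairDiff (fun x => max (a x - b x) 0) z| ≤ |pairDiff a z| + |pairDiff b z| := by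
  simp only [pairDiff]
  refine (abs_max_sub_max_le_max _ _ _ _).trans (max_le ?_ (by simp; positivity))
  calc |a z.1 - b z.1 - (a z.2 - b z.2)| = |(a z.1 - a z.2) - (b z.1 - b z.2)| := by congr 1; ring
    _ ≤ _ := abs_sub _ _

/-- Lowering a function by the truncation at level `ε` decreases its weak form, tested with
functions supported where the truncation is positive. -/
lemma oddPow_pairDiff_mul_le (hp : 1 < p) {φ : Space N → ℝ} {ε : ℝ} (hφ : ∀ x, 0 ≤ φ x)
    (hφu : ∀ x, 0 < φ x → ε < u x) (z : Space N × Space N) :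
    oddPow p (pairDiff (fun x => max (u x - ε) 0) z) * pairDiff φ z ≤
      oddPow p (pairDiff u z) * pairDiff φ z := by
  have hmono := (oddPow_strictMono hp).monotone
  -- Where φ is positive the truncation is exactly u - ε; at the other point it is at least u - ε,
  -- so the increment can only drop.
  have h : ∀ a : Space N, ∀ b : Space N, 0 < φ a → max (u a - ε) 0 - max (u b - ε) 0 ≤ u a - u b :=
    fun a b ha => by
      rw [max_eq_left (by linarith [hφu a ha])]
      linarith [le_max_left (u b - ε) 0]
  rcases lt_trichotomy (pairDiff φ z) 0 with hd | hd | hd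
  · have h2 : 0 < φ z.2 := by have := hφ z.1; simp only [pairDiff] at hd; linarith
    refine mul_le_mul_of_nonpos_right (hmono ?_) hd.le
    have := h z.2 z.1 h2
    simp only [pairDiff]
    linarith
  · simp [hd]
  · have h1 : 0 < φ z.1 := by have := hφ z.2; simp only [pairDiff] at hd; linarith
    exact mul_le_mul_of_nonneg_right (hmono (h z.1 z.2 h1)) hd.le

/-- A function which vanishes outside `Ω` and has zero differences almost everywhere for the
Gagliardo measure vanishes. -/
lemma ae_eq_zero_of_pairDiff_eq_zero [NeZero N] (hΩ : Bornology.IsBounded Ω)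
    (hΩm : MeasurableSet Ω) {φ : Space N → ℝ} (hφ0 : ∀ x ∉ Ω, φ x = 0)
    (h : ∀ᵐ z ∂gagliardoMeasure N s p, pairDiff φ z = 0) : ∀ᵐ x, φ x = 0 := by
  rw [gagliardoMeasure, ae_withDensity_iff measurable_kernel] at h
  filter_upwards [Measure.ae_ae_of_ae_prod h] with x hx
  by_cases hxΩ : x ∈ Ω
  · have hne : ∃ᵐ y, y ∈ Ωᶜ := by
      rw [frequently_ae_mem_iff, volume_compl_eq_top hΩ hΩm]
      exact ENNReal.top_ne_zero
    obtain ⟨y, hy, hxy⟩ := (hne.and_eventually hx).exists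
    have hpos : 0 < ‖x - y‖ := norm_pos_iff.2 (sub_ne_zero.2 fun e => hy (e ▸ hxΩ))
    have := hxy (by rw [ENNReal.ofReal_ne_zero_iff]; positivity)
    simpa [pairDiff, hφ0 y hy] using this
  · exact hφ0 x hxΩ

variable [NeZero N]

/-- Comparison of weak solutions up to a level `ε`. -/
lemma IsWeakSolution.le_add_of_level (hs₀ : 0 < s) (hs₁ : s < 1) (hp : 1 < p) (hγ : 0 < γ)
    (hΩ : IsSmoothBoundedDomain Ω) (hf₀ : ∀ᵐ x ∂(volume.restrict Ω), 0 ≤ f x)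
    (hu : IsWeakSolution s p γ Ω f u) (hum : Measurable u)
    (hu0 : ∀ x ∉ Ω, u x = 0) (hv : IsWeakSolution s p γ Ω f v) (hvm : Measurable v)
    (hvn : ∀ x, 0 ≤ v x) (hv0 : ∀ x ∉ Ω, v x = 0) {ε : ℝ} (hε : 0 < ε)
    (hw : gagliardo s p univ (fun x => max (u x - ε) 0) < ⊤) : ∀ᵐ x, u x ≤ v x + ε := by
  set w : Space N → ℝ := fun x => max (u x - ε) 0 with hwdef
  have hwm : Measurable w := (hum.sub_const ε).max measurable_const
  have hwn : ∀ x, 0 ≤ w x := fun x => le_max_right _ _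
  have hw0 : ∀ x ∉ Ω, w x = 0 := fun x hx => by
    simp only [hwdef, hu0 x hx]; exact max_eq_right (by linarith)
  set m := truncation Ω w with hm
  have hmm : ∀ n, Measurable (m n) := measurable_truncation hwm
  set G := truncationMajorant Ω w with hG
  have hGm : Measurable G := measurable_truncationMajorant hwm
  have hGn : ∀ z, 0 ≤ G z := truncationMajorant_nonneg w
  have hGfin := lintegral_truncationMajorant_lt_top hΩ hs₀ hs₁ hp hwm hw0 hw
  have hmG : ∀ n z, |pairDiff (m n) z| ≤ G z := abs_pairDiff_truncation_le hΩ hwn hw0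
  have hwG : ∀ z, |pairDiff w z| ≤ G z := fun z => by
    refine le_add_of_nonneg_right (mul_nonneg (abs_nonneg _) (le_min zero_le_one
      (div_nonneg (norm_nonneg _) (div_nonneg (distCompl_nonneg _) (by norm_num)))))
  -- Truncating w before subtracting v ≥ 0 confines the test function below m n: it inherits the
  -- compact support and the bound n, while v enters only through its local energy.
  set φ : ℕ → Space N → ℝ := fun n x => max (m n x - v x) 0 with hφ
  have hφm : ∀ n, Measurable (φ n) := fun n => ((hmm n).sub hvm).max measurable_const
  have hφn : ∀ n x, 0 ≤ φ n x := fun n x => le_max_right _ _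
  have hφle : ∀ n x, φ n x ≤ m n x := fun n x =>
    max_le (by linarith [hvn x]) (truncation_nonneg hwn n x)
  have hφM : ∀ n x, |φ n x| ≤ n := fun n x => by
    rw [abs_of_nonneg (hφn n x)]
    exact (hφle n x).trans (truncation_le_natCast hwn n x)
  have hφK : ∀ n, ∀ x ∉ cutoffSupport Ω n, φ n x = 0 := fun n x hx =>
    le_antisymm ((hφle n x).trans (by rw [hm, truncation, cutoff_eq_zero hx, zero_mul])) (hφn n x)
  have hφpos : ∀ n x, 0 < φ n x → v x < w x := fun n x h => by
    have h1 : 0 < m n x - v x := by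
      by_contra! h'
      simp only [hφ, max_eq_right h'] at h
      exact lt_irrefl _ h
    linarith [truncation_le (Ω := Ω) hwn n x]
  have hwu : ∀ x, 0 < w x → w x = u x - ε := fun x h => by
    rcases le_total (u x - ε) 0 with h' | h'
    · simp only [hwdef, max_eq_right h'] at h; exact absurd h (lt_irrefl _)
    · exact max_eq_left h'
  have hφu : ∀ n x, 0 < φ n x → ε + v x < u x := fun n x h => by
    have h1 := hφpos n x h
    rw [hwu x ((hvn x).trans_lt h1)] at h1
    linarith
  have hφL : ∀ n L, IsCompact L → L ⊆ Ω → gagliardo s p L (φ n) < ⊤ := fun n L hL hLΩ => by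
    have hvL := (hv.memWloc L hL hLΩ).2
    rw [gagliardo_eq hL.measurableSet] at hvL ⊢
    refine lt_of_le_of_lt (lintegral_add_rpow_le (by linarith) hGn (fun _ => abs_nonneg _) hGm
      (fun _ => abs_nonneg _) (b := fun z => |pairDiff v z|) fun z =>
        (abs_pairDiff_max_sub_le (m n) v z).trans (add_le_add_left (hmG n z) _)) ?_
    exact ENNReal.mul_lt_top ENNReal.ofReal_lt_top (ENNReal.add_lt_top.2
      ⟨(setLIntegral_le_lintegral _ _).trans_lt hGfin, hvL⟩)
  have hcs : ∀ n, IsCompact (cutoffSupport Ω n) := isCompact_cutoffSupport hΩ.isBounded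
  have htu := fun n => hu.weakForm_eq_of_bounded hs₀ hs₁ hp hΩ.isOpen hum hu0 (hφm n) (hφM n)
    (hcs n) (cutoffSupport_subset n) (hφK n) (hφL n)
  have htv := fun n => hv.weakForm_eq_of_bounded hs₀ hs₁ hp hΩ.isOpen hvm hv0 (hφm n) (hφM n)
    (hcs n) (cutoffSupport_subset n) (hφK n) (hφL n)
  have hvnonneg : ∀ n, 0 ≤ weakForm s p v (φ n) := fun n => by
    rw [(htv n).2.2]
    refine integral_nonneg_of_ae ?_
    filter_upwards [hf₀] with x hx
    exact mul_nonneg (div_nonneg hx (Real.rpow_nonneg (hvn x) γ)) (hφn n x)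
  -- On the set where φ n > 0 one has u > v + ε, and t ↦ f/t^γ is nonincreasing.
  have huv : ∀ n, weakForm s p u (φ n) ≤ weakForm s p v (φ n) := fun n => by
    rw [(htu n).2.2, (htv n).2.2]
    refine integral_mono_ae (htu n).2.1 (htv n).2.1 ?_
    filter_upwards [hf₀, hv.pos] with x hx hvx
    rcases (hφn n x).eq_or_lt with h | h
    · simp [← h]
    · refine mul_le_mul_of_nonneg_right (div_le_div_of_nonneg_left hx (Real.rpow_pos_of_pos hvx γ)
        (Real.rpow_le_rpow hvx.le ?_ hγ.le)) h.le
      linarith [hφu n x h]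
  have hJm : ∀ {g : Space N → ℝ}, Measurable g → Measurable fun z => oddPow p (pairDiff g z) :=
    fun hg => (measurable_oddPow hp).comp (measurable_pairDiff hg)
  -- uniform energy bound for the test functions
  have hGi : Integrable (fun z => 2 ^ (p + 1) * G z ^ p) (gagliardoMeasure N s p) := by
    refine Integrable.const_mul ⟨(hGm.pow_const p).aestronglyMeasurable, ?_⟩ _
    refine lt_of_eq_of_lt (lintegral_congr fun z => ?_) hGfin
    rw [Real.enorm_eq_ofReal (Real.rpow_nonneg (hGn z) p)]
  have henergy : ∀ n, ∫⁻ z, ENNReal.ofReal (|pairDiff (φ n) z| ^ p) ∂gagliardoMeasure N s p ≤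
      ENNReal.ofReal (∫ z, 2 ^ (p + 1) * G z ^ p ∂gagliardoMeasure N s p) := fun n => by
    -- Absorption with the increments of m n and v. The v-term integrates to -2^{p-1} times a
    -- nonnegative weak form and is discarded, so no global energy of v is needed.
    have hle : ∀ z, |pairDiff (φ n) z| ^ p ≤
        2 ^ (p - 1) * -(oddPow p (pairDiff v z) * pairDiff (φ n) z) + 2 ^ (p + 1) * G z ^ p :=
      fun z => (abs_rpow_le_absorb hp pairDiff_max_sub_le le_pairDiff_max_sub).trans (by
        gcongr
        exact hmG n z)
    have hi₁ : Integrable (fun z => 2 ^ (p - 1) * -(oddPow p (pairDiff v z) * pairDiff (φ n) z))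
        (gagliardoMeasure N s p) := (htv n).1.neg.const_mul _
    have hi := hi₁.add hGi
    calc _ ≤ ∫⁻ z, ENNReal.ofReal (2 ^ (p - 1) * -(oddPow p (pairDiff v z) * pairDiff (φ n) z) +
          2 ^ (p + 1) * G z ^ p) ∂gagliardoMeasure N s p :=
          lintegral_mono fun z => ENNReal.ofReal_le_ofReal (hle z)
      _ = ENNReal.ofReal (∫ z, 2 ^ (p - 1) * -(oddPow p (pairDiff v z) * pairDiff (φ n) z) +
          2 ^ (p + 1) * G z ^ p ∂gagliardoMeasure N s p) :=
          (ofReal_integral_eq_lintegral_ofReal hi (Eventually.of_forall fun z =>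
            (Real.rpow_nonneg (abs_nonneg _) p).trans (hle z))).symm
      _ ≤ _ := by
          refine ENNReal.ofReal_le_ofReal ?_
          rw [integral_add hi₁ hGi, integral_const_mul,
            integral_neg, ← weakForm_eq]
          have : 0 ≤ (2 : ℝ) ^ (p - 1) * weakForm s p v (φ n) :=
            mul_nonneg (by positivity) (hvnonneg n)
          linarith
  -- the error of replacing `w` by its truncations
  set R : ℕ → Space N × Space N → ℝ := fun n z =>
    |oddPow p (pairDiff w z) - oddPow p (pairDiff (m n) z)| * |pairDiff (φ n) z| with hR
  have hRm : ∀ n, Measurable (R n) := fun n =>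
    ((hJm hwm).sub (hJm (hmm n))).abs.mul (measurable_pairDiff (hφm n)).abs
  have hRn : ∀ n z, 0 ≤ R n z := fun n z => mul_nonneg (abs_nonneg _) (abs_nonneg _)
  have hRle : ∀ n z, R n z ≤ G z ^ (p - 1) * (2 * |pairDiff (φ n) z|) := fun n z => by
    have h1 : ∀ t, |t| ≤ G z → |oddPow p t| ≤ G z ^ (p - 1) := fun t ht => by
      rw [abs_oddPow hp]
      exact Real.rpow_le_rpow (abs_nonneg _) ht (by linarith)
    calc R n z ≤ (G z ^ (p - 1) + G z ^ (p - 1)) * |pairDiff (φ n) z| := by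
          refine mul_le_mul_of_nonneg_right ?_ (abs_nonneg _)
          exact (abs_sub _ _).trans (add_le_add (h1 _ (hwG z)) (h1 _ (hmG n z)))
      _ = _ := by ring
  have h2energy : ∀ n, ∫⁻ z, ENNReal.ofReal ((2 * |pairDiff (φ n) z|) ^ p)
      ∂gagliardoMeasure N s p ≤ ENNReal.ofReal (2 ^ p) *
      ENNReal.ofReal (∫ z, 2 ^ (p + 1) * G z ^ p ∂gagliardoMeasure N s p) := fun n => by
    refine le_trans (le_of_eq ?_) (mul_le_mul_right (henergy n) _)
    rw [← lintegral_const_mul' _ _ ENNReal.ofReal_ne_top]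
    refine lintegral_congr fun z => ?_
    rw [← ENNReal.ofReal_mul (by positivity), Real.mul_rpow (by norm_num) (abs_nonneg _)]
  have hmlim : ∀ x, Tendsto (fun n => m n x) atTop (𝓝 (w x)) := tendsto_truncation hΩ hw0
  have hφlim : ∀ z, Tendsto (fun n => pairDiff (φ n) z) atTop
      (𝓝 (pairDiff (fun x => max (w x - v x) 0) z)) := fun z =>
    (((hmlim z.1).sub_const _).max tendsto_const_nhds).sub
      (((hmlim z.2).sub_const _).max tendsto_const_nhds)
  have hRlim : ∀ z, Tendsto (fun n => R n z) atTop (𝓝 0) := fun z => by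
    have h1 : Tendsto (fun n => oddPow p (pairDiff (m n) z)) atTop (𝓝 (oddPow p (pairDiff w z))) :=
      ((continuous_oddPow hp).tendsto _).comp ((hmlim z.1).sub (hmlim z.2))
    have h2 := ((tendsto_const_nhds (x := oddPow p (pairDiff w z))).sub h1).abs.mul (hφlim z).abs
    simpa using h2
  have hRint := tendsto_lintegral_zero_of_le_rpow_mul (ν := gagliardoMeasure N s p) hp hGn hGm
    hGfin.ne (fun n z => mul_nonneg zero_le_two (abs_nonneg (pairDiff (φ n) z)))
    (fun n => (measurable_pairDiff (hφm n)).abs.const_mul 2)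
    (ENNReal.mul_lt_top ENNReal.ofReal_lt_top ENNReal.ofReal_lt_top).ne h2energy hRm hRle
    (Eventually.of_forall hRlim)
  have hRi : ∀ n, Integrable (R n) (gagliardoMeasure N s p) := fun n => by
    refine ⟨(hRm n).aestronglyMeasurable, ?_⟩
    refine lt_of_le_of_lt (lintegral_mono fun z => ?_) ((lintegral_rpow_sub_one_mul_le hp hGn
      (fun z => mul_nonneg zero_le_two (abs_nonneg (pairDiff (φ n) z))) hGm).trans_lt
      (ENNReal.add_lt_top.2 ⟨hGfin, (h2energy n).trans_lt
        (ENNReal.mul_lt_top ENNReal.ofReal_lt_top ENNReal.ofReal_lt_top)⟩))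
    rw [Real.enorm_eq_ofReal (hRn n z)]
    exact ENNReal.ofReal_le_ofReal (hRle n z)
  -- Adding R n makes the integrand nonnegative, as Fatou requires: with m n in place of w the
  -- product is nonnegative by monotonicity, and R n covers the difference.
  set F : ℕ → Space N × Space N → ℝ := fun n z =>
    (oddPow p (pairDiff w z) - oddPow p (pairDiff v z)) * pairDiff (φ n) z + R n z with hF
  have hFn : ∀ n z, 0 ≤ F n z := fun n z => by
    have h1 := oddPow_sub_mul_nonneg hp (pairDiff_max_sub_le (a := m n) (b := v) (z := z))
      le_pairDiff_max_sub
    have h2 := neg_abs_le ((oddPow p (pairDiff w z) - oddPow p (pairDiff (m n) z)) *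
      pairDiff (φ n) z)
    rw [abs_mul] at h2
    change 0 ≤ (oddPow p (pairDiff (m n) z) - oddPow p (pairDiff v z)) * pairDiff (φ n) z at h1
    simp only [hF, hR]
    linarith
  -- Passing from w to u only increases the integrand; then the weak form of u minus that of v is at
  -- most 0, and only the integral of R n survives.
  have hFint : ∀ n, ∫⁻ z, ENNReal.ofReal (F n z) ∂gagliardoMeasure N s p ≤
      ∫⁻ z, ENNReal.ofReal (R n z) ∂gagliardoMeasure N s p := fun n => by
    set F' : Space N × Space N → ℝ := fun z => oddPow p (pairDiff u z) * pairDiff (φ n) z -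
      oddPow p (pairDiff v z) * pairDiff (φ n) z + R n z with hF'
    have hFF' : ∀ z, F n z ≤ F' z := fun z => by
      have := oddPow_pairDiff_mul_le (u := u) hp (hφn n)
        (fun x hx => by linarith [hφu n x hx, hvn x] : ∀ x, 0 < φ n x → ε < u x) z
      simp only [hF, hF', hwdef] at this ⊢
      linarith
    have hi₁ : Integrable (fun z => oddPow p (pairDiff u z) * pairDiff (φ n) z -
        oddPow p (pairDiff v z) * pairDiff (φ n) z) (gagliardoMeasure N s p) :=
      (htu n).1.sub (htv n).1
    have hi := hi₁.add (hRi n)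
    calc _ ≤ ∫⁻ z, ENNReal.ofReal (F' z) ∂gagliardoMeasure N s p :=
          lintegral_mono fun z => ENNReal.ofReal_le_ofReal (hFF' z)
      _ = ENNReal.ofReal (∫ z, F' z ∂gagliardoMeasure N s p) :=
          (ofReal_integral_eq_lintegral_ofReal hi
            (Eventually.of_forall fun z => (hFn n z).trans (hFF' z))).symm
      _ ≤ ENNReal.ofReal (∫ z, R n z ∂gagliardoMeasure N s p) := by
          refine ENNReal.ofReal_le_ofReal ?_
          simp only [hF']
          rw [integral_add hi₁ (hRi n), integral_sub (htu n).1 (htv n).1,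
            ← weakForm_eq, ← weakForm_eq]
          linarith [huv n]
      _ = _ := ofReal_integral_eq_lintegral_ofReal (hRi n) (Eventually.of_forall (hRn n))
  set φ₀ : Space N → ℝ := fun x => max (w x - v x) 0 with hφ₀
  have hFm : ∀ n, Measurable (F n) := fun n =>
    (((hJm hwm).sub (hJm hvm)).mul (measurable_pairDiff (hφm n))).add (hRm n)
  have hzero : ∫⁻ z, ENNReal.ofReal ((oddPow p (pairDiff w z) - oddPow p (pairDiff v z)) *
      pairDiff φ₀ z) ∂gagliardoMeasure N s p = 0 := by
    have hlim : ∀ z, Tendsto (fun n => ENNReal.ofReal (F n z)) atTop (𝓝 (ENNReal.ofReal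
        ((oddPow p (pairDiff w z) - oddPow p (pairDiff v z)) * pairDiff φ₀ z))) := fun z => by
      refine ENNReal.tendsto_ofReal ?_
      have := ((hφlim z).const_mul
        (oddPow p (pairDiff w z) - oddPow p (pairDiff v z))).add (hRlim z)
      rwa [add_zero] at this
    rw [← nonpos_iff_eq_zero]
    calc _ = ∫⁻ z, liminf (fun n => ENNReal.ofReal (F n z)) atTop ∂gagliardoMeasure N s p :=
          lintegral_congr fun z => (hlim z).liminf_eq.symm
      _ ≤ liminf (fun n => ∫⁻ z, ENNReal.ofReal (F n z) ∂gagliardoMeasure N s p) atTop :=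
          lintegral_liminf_le fun n => (hFm n).ennreal_ofReal
      _ ≤ liminf (fun n => ∫⁻ z, ENNReal.ofReal (R n z) ∂gagliardoMeasure N s p) atTop :=
          liminf_le_liminf (Eventually.of_forall hFint)
      _ = 0 := hRint.liminf_eq
  have hφ₀m : Measurable φ₀ := (hwm.sub hvm).max measurable_const
  have hm₀ : Measurable fun z => ENNReal.ofReal
      ((oddPow p (pairDiff w z) - oddPow p (pairDiff v z)) * pairDiff φ₀ z) :=
    (((hJm hwm).sub (hJm hvm)).mul (measurable_pairDiff hφ₀m)).ennreal_ofReal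
  rw [lintegral_eq_zero_iff hm₀] at hzero
  -- A nonzero increment of φ₀ would make the increments of w and v differ strictly in the same
  -- direction, so the product would be positive by strict monotonicity.
  have hdiff : ∀ᵐ z ∂gagliardoMeasure N s p, pairDiff φ₀ z = 0 := by
    filter_upwards [hzero] with z hz
    have hz' := ENNReal.ofReal_eq_zero.1 hz
    by_contra hne
    rcases lt_or_gt_of_ne hne with h | h
    · have h1 := le_pairDiff_max_sub h
      have := (oddPow_strictMono hp) (by linarith : pairDiff w z < pairDiff v z)
      nlinarith
    · have h1 := pairDiff_max_sub_le h
      have := (oddPow_strictMono hp) (by linarith : pairDiff v z < pairDiff w z)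
      nlinarith
  have hφ₀0 : ∀ x ∉ Ω, φ₀ x = 0 := fun x hx => by simp [hφ₀, hw0 x hx, hv0 x hx]
  filter_upwards [ae_eq_zero_of_pairDiff_eq_zero hΩ.isBounded hΩ.isOpen.measurableSet hφ₀0 hdiff]
    with x hx
  have h1 : w x - v x ≤ 0 := by rw [← hx]; exact le_max_left _ _
  have h2 : u x - ε ≤ w x := le_max_left _ _
  linarith

/-- Comparison principle: a weak solution vanishing on the boundary is below any weak solution. -/
theorem IsWeakSolution.ae_le (hs₀ : 0 < s) (hs₁ : s < 1) (hp : 1 < p) (hγ : 0 < γ)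
    (hΩ : IsSmoothBoundedDomain Ω) (hf₀ : ∀ᵐ x ∂(volume.restrict Ω), 0 ≤ f x)
    (hu : IsWeakSolution s p γ Ω f u) (hu₀ : LeZeroOnBoundary s p Ω u)
    (hv : IsWeakSolution s p γ Ω f v) : u ≤ᵐ[volume] v := by
  obtain ⟨u', hum, -, hu0, huu⟩ := hu.exists_measurable_representative hΩ.isOpen
  obtain ⟨v', hvm, hvn, hv0, hvv⟩ := hv.exists_measurable_representative hΩ.isOpen
  have h : ∀ n : ℕ, ∀ᵐ x, u' x ≤ v' x + 1 / ((n : ℝ) + 1) := fun n => by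
    have hε : (0 : ℝ) < 1 / ((n : ℝ) + 1) := by positivity
    refine (hu.congr huu).le_add_of_level hs₀ hs₁ hp hγ hΩ hf₀ hum hu0 (hv.congr hvv) hvm hvn
      hv0 hε ?_
    refine lt_of_eq_of_lt (gagliardo_congr ?_) (hu₀ _ hε).1.2
    filter_upwards [huu] with x hx
    rw [hx]
  filter_upwards [ae_all_iff.2 h, huu, hvv] with x hx h1 h2
  rw [h1, h2]
  have hlim : Tendsto (fun n : ℕ => v' x + 1 / ((n : ℝ) + 1)) atTop (𝓝 (v' x)) := by
    simpa using (tendsto_const_nhds (x := v' x)).add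
      (tendsto_one_div_add_atTop_nhds_zero_nat (𝕜 := ℝ))
  exact ge_of_tendsto hlim (Eventually.of_forall hx)

end

end FracPLaplace

theorem theorem2 (N : ℕ) (s p γ : ℝ) (hs₀ : 0 < s) (hs₁ : s < 1) (hp : 1 < p)
    (hN : s * p < (N : ℝ)) (hγ : 0 < γ)
    (Ω : Set (FracPLaplace.Space N)) (hΩ : FracPLaplace.IsSmoothBoundedDomain Ω)
    (f : FracPLaplace.Space N → ℝ) (hf : IntegrableOn f Ω volume)
    (hf₀ : ∀ᵐ x ∂(volume.restrict Ω), 0 ≤ f x)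
    (u v : FracPLaplace.Space N → ℝ)
    (hu : FracPLaplace.IsWeakSolution s p γ Ω f u) (hu₀ : FracPLaplace.EqZeroOnBoundary s p Ω u)
    (hv : FracPLaplace.IsWeakSolution s p γ Ω f v) (hv₀ : FracPLaplace.EqZeroOnBoundary s p Ω v) :
    u =ᵐ[volume] v := by
  have : NeZero N := ⟨by
    rintro rfl
    have : 0 < s * p := by positivity
    simp only [Nat.cast_zero] at hN
    linarith⟩
  exact (hu.ae_le hs₀ hs₁ hp hγ hΩ hf₀ hu₀.2 hv).antisymm
    (hv.ae_le hs₀ hs₁ hp hγ hΩ hf₀ hv₀.2 hu)
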